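/- Let $n \ge 2$ and let $G$ be a group isomorphic to $C_2 \oplus C_2 \oplus C_{2n}$, where $C_m$ denotes the cyclic group of order $m$. A sequence over $G$ is a finite unordered sequence of elements of $G$, repetition allowed (a multiset); its height $\mathsf{h}(S)$ is the maximal multiplicity of an element in $S$. Let $\mathsf{s}(G)$ denote the Erdős–Ginzburg–Ziv constant, i.e. the smallest nonnegative integer $\ell$ such that each sequence over $G$ of length at least $\ell$ has a subsequence of length $\exp(G)$ with sum $0$ (here $\exp(G)=2n$ is the exponent of $G$). Then every sequence $S$ over $G$ of length $|S| = \mathsf{s}(G)-1$ without a zero-sum subsequence of length $\exp(G)$ satisfies \[ \mathsf{h}(S) \ge \begin{cases} \frac{2n+3}{3} & \text{if } n \equiv 0 \pmod 3,\\ \frac{2n+1}{3} & \text{if } n \equiv 1 \pmod 3,\\ \frac{2n+5}{3} & \text{if } n \equiv 2 \pmod 3, \end{cases} \] and, for every $n\ge 2$, this bound is attained by some such sequence. Explicitly, for every basis (independent generating family) $(f_1,f_2,f_3)$ of $G$ with $\operatorname{ord}(f_1)=\operatorname{ord}(f_2)=2$ and $\operatorname{ord}(f_3)=2n$, the sequence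 \[ 0^{2\alpha+1}\, f_1^{2\beta+1}\, f_2^{2\gamma+1}\, (f_3+f_1)^{2\alpha+1}\, (f_3+f_2)^{2\beta+1}\, (f_3+f_1+f_2)^{2\gamma+1} \] (exponents denote multiplicities), with $(\alpha,\beta,\gamma)$ equal to $\left(\frac n3,\frac n3,\frac{n-3}3\right)$, $\left(\frac{n-1}3,\frac{n-1}3,\frac{n-1}3\right)$ or $\left(\frac{n+1}3,\frac{n-2}3,\frac{n-2}3\right)$ according as $n\equiv 0,1,2 \pmod 3$, has length $\mathsf{s}(G)-1$, has no zero-sum subsequence of length $\exp(G)$, and has height equal to the bound. -/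

import Mathlib

/-- `S` has a zero-sum subsequence of length `k`. A (finite, unordered) sequence over `G` is an
element of the free abelian monoid over `G`, i.e. a multiset; its length is `Multiset.card`,
its subsequences are the `T ≤ S`, and the multiplicity of `g` is `Multiset.count g S`. -/
def HasZeroSumSubseq {G : Type*} [AddCommGroup G] (k : ℕ) (S : Multiset G) : Prop :=
  ∃ T : Multiset G, T ≤ S ∧ Multiset.card T = k ∧ T.sum = 0

/-- The Erdős–Ginzburg–Ziv constant `s(G)`: the smallest `ℓ` such that each sequence over `G` of
length at least `ℓ` has a zero-sum subsequence of length `exp(G)`. -/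
noncomputable def egzConstant (G : Type*) [AddCommGroup G] : ℕ :=
  sInf {l : ℕ | ∀ S : Multiset G, l ≤ Multiset.card S →
    HasZeroSumSubseq (AddMonoid.exponent G) S}

/-- For a finite group the set defining `egzConstant G` is nonempty, so the infimum is attained. -/
theorem egzConstant_set_nonempty (G : Type*) [AddCommGroup G] [Finite G] :
    {l : ℕ | ∀ S : Multiset G, l ≤ Multiset.card S →
      HasZeroSumSubseq (AddMonoid.exponent G) S}.Nonempty := by
  classical
  cases nonempty_fintype G
  refine ⟨Fintype.card G * AddMonoid.exponent G, fun S hS => ?_⟩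
  have h1 : ∑ g : G, S.count g = Multiset.card S :=
    Multiset.sum_count_eq_card (fun a _ => Finset.mem_univ a)
  obtain ⟨g, -, hg⟩ : ∃ g ∈ (Finset.univ : Finset G), AddMonoid.exponent G ≤ S.count g := by
    apply Finset.exists_le_of_sum_le Finset.univ_nonempty
    rw [h1, Finset.sum_const, smul_eq_mul, Finset.card_univ]
    exact hS
  refine ⟨Multiset.replicate (AddMonoid.exponent G) g, Multiset.le_count_iff_replicate_le.1 hg,
    Multiset.card_replicate _ _, ?_⟩
  rw [Multiset.sum_replicate, AddMonoid.exponent_nsmul_eq_zero]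

/-- `S` is an extremal sequence for `s(G)`: its length is `s(G) - 1` and it has no zero-sum
subsequence of length `exp(G)`. -/
def IsExtremalEGZ {G : Type*} [AddCommGroup G] (S : Multiset G) : Prop :=
  Multiset.card S + 1 = egzConstant G ∧ ¬ HasZeroSumSubseq (AddMonoid.exponent G) S

open Classical in
/-- The height `h(S)`: the maximal multiplicity of an element in `S`. -/
noncomputable def height {G : Type*} (S : Multiset G) : ℕ :=
  S.toFinset.sup fun g => S.count g

/-- `f` is a basis of the abelian group `G`: an independent generating family. -/
def IsGroupBasis {G ι : Type*} [AddCommGroup G] [Fintype ι] (f : ι → G) : Prop :=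
  (∀ a : ι → ℤ, ∑ i, a i • f i = 0 → ∀ i, a i • f i = 0) ∧
    AddSubgroup.closure (Set.range f) = ⊤

/-- The lower bound for the height of extremal sequences over `C₂ ⊕ C₂ ⊕ C₂ₙ`. -/
def heightBound (n : ℕ) : ℚ :=
  if n % 3 = 0 then (2 * (n : ℚ) + 3) / 3
  else if n % 3 = 1 then (2 * (n : ℚ) + 1) / 3
  else (2 * (n : ℚ) + 5) / 3

/-- The triple `(α, β, γ)` of parameters of the explicit sequence. For `2 ≤ n` all divisions are
exact and no subtraction truncates. -/
def heightParams (n : ℕ) : ℕ × ℕ × ℕ :=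
  if n % 3 = 0 then (n / 3, n / 3, (n - 3) / 3)
  else if n % 3 = 1 then ((n - 1) / 3, (n - 1) / 3, (n - 1) / 3)
  else ((n + 1) / 3, (n - 2) / 3, (n - 2) / 3)

/-- The sequence
`0^(2α+1) f₁^(2β+1) f₂^(2γ+1) (f₃+f₁)^(2α+1) (f₃+f₂)^(2β+1) (f₃+f₁+f₂)^(2γ+1)`. -/
def lowHeightSeq {G : Type*} [AddCommGroup G] (p : ℕ × ℕ × ℕ) (f₁ f₂ f₃ : G) : Multiset G :=
  Multiset.replicate (2 * p.1 + 1) 0 + Multiset.replicate (2 * p.2.1 + 1) f₁ +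
    Multiset.replicate (2 * p.2.2 + 1) f₂ + Multiset.replicate (2 * p.1 + 1) (f₃ + f₁) +
    Multiset.replicate (2 * p.2.1 + 1) (f₃ + f₂) +
    Multiset.replicate (2 * p.2.2 + 1) (f₃ + (f₁ + f₂))

/-! `G` maps onto `C₂³` with cyclic kernel of order `n`. Two terms in one class have their sum in
the kernel, and so do four terms whose classes form an affine plane. Let `S` have `4n + 2` terms and
no zero-sum subsequence of length `2n`. Pair off terms within classes until the remainder `T` has
distinct classes. No `n` of the pair sums add up to zero, so Erdős–Ginzburg–Ziv in the kernel allows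
at most `2n - 2` pairs; hence `T` has 6 or 8 terms.

The inverse theorem for cyclic groups (`inverseEGZ`) says that `2n - 2` such sums have the form
`a^(n-1) b^(n-1)`. This is rigid: exchanging a term of a pair for another term of its class cannot
change the sequence. If terms in at least seven classes were available, all planes among them would
have sum `a + b`, which forces `4z = a + b`; a pair in such a class would be `{z, z}` with `2z = a`
or `2z = b`, whence `a = b`, a contradiction. So `T` has six terms and every pair repeats a term of
`T`: `S` has exactly six distinct terms, each of odd multiplicity
(`odd_count_of_not_hasZeroSumSubseq`).

Deleting one term from a sequence of length `4n + 3` then shows `s(G) ≤ 4n + 3`, and the height is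
at least the least odd integer that is `≥ (4n + 2)/6`. A parity argument shows that the explicit
sequence has no zero-sum subsequence of length `2n`. -/

/-! ### Multisets, blocks and block sums. -/

theorem HasZeroSumSubseq.mono {G : Type*} [AddCommGroup G] {k : ℕ} {S T : Multiset G}
    (h : HasZeroSumSubseq k S) (hST : S ≤ T) : HasZeroSumSubseq k T := by
  obtain ⟨U, hU, h1, h2⟩ := h
  exact ⟨U, hU.trans hST, h1, h2⟩

theorem Multiset.exists_le_map_eq {α β : Type*} {f : α → β} {s : Multiset α} {t : Multiset β}
    (h : t ≤ s.map f) : ∃ u ≤ s, u.map f = t := by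
  classical
  induction s using Multiset.induction_on generalizing t with
  | empty => exact ⟨0, le_rfl, by simpa using (Multiset.le_zero.1 (by simpa using h)).symm⟩
  | cons a s ih =>
    rw [Multiset.map_cons] at h
    by_cases ha : f a ∈ t
    · obtain ⟨u, hu, rfl⟩ := Multiset.exists_cons_of_mem ha
      obtain ⟨v, hv, rfl⟩ := ih ((Multiset.cons_le_cons_iff _).1 h)
      exact ⟨a ::ₘ v, Multiset.cons_le_cons _ hv, by simp⟩
    · obtain ⟨v, hv, rfl⟩ := ih ((Multiset.le_cons_of_notMem ha).1 h)
      exact ⟨v, hv.trans (Multiset.le_cons_self _ _), rfl⟩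

theorem Multiset.join_le_join {α : Type*} {s t : Multiset (Multiset α)} (h : s ≤ t) :
    s.join ≤ t.join := by
  obtain ⟨u, rfl⟩ := Multiset.le_iff_exists_add.1 h
  simp

theorem Multiset.sum_join' {G : Type*} [AddCommMonoid G] (B : Multiset (Multiset G)) :
    B.join.sum = (B.map Multiset.sum).sum := by
  induction B using Multiset.induction_on with
  | empty => simp
  | cons a s ih => simp [ih]

theorem Multiset.card_join_of_forall {α : Type*} {B : Multiset (Multiset α)} {k : ℕ}
    (h : ∀ b ∈ B, Multiset.card b = k) : Multiset.card B.join = Multiset.card B * k := by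
  rw [Multiset.card_join, Multiset.map_congr rfl h]
  simp

/-- Zero-sum subsequences of the sequence of block sums yield zero-sum subsequences. -/
theorem HasZeroSumSubseq.of_blocks {G : Type*} [AddCommGroup G] {m k l : ℕ}
    {B : Multiset (Multiset G)} {S : Multiset G} (hB : ∀ b ∈ B, Multiset.card b = k)
    (hS : B.join ≤ S) (h : HasZeroSumSubseq m (B.map Multiset.sum)) (hl : m * k = l) :
    HasZeroSumSubseq l S := by
  obtain ⟨T, hT, h1, h2⟩ := h
  obtain ⟨C, hC, rfl⟩ := Multiset.exists_le_map_eq hT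
  refine ⟨C.join, (Multiset.join_le_join hC).trans hS, ?_, ?_⟩
  · rw [Multiset.card_join_of_forall fun b hb => hB b (Multiset.mem_of_le hC hb)]
    rw [Multiset.card_map] at h1
    rw [h1, hl]
  · rw [Multiset.sum_join', h2]

theorem Multiset.sum_replicate_add {G : Type*} [AddCommMonoid G] (i j : ℕ) (a b : G) :
    (Multiset.replicate i a + Multiset.replicate j b).sum = i • a + j • b := by
  simp

/-! ### Extremal sequences with two values in a group of order `n`. -/

theorem AddSubgroup.nsmul_eq_zero_of_card {G : Type*} [AddCommGroup G] {H : AddSubgroup G} {n : ℕ}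
    (hH : Nat.card H = n) {x : G} (hx : x ∈ H) : n • x = 0 := by
  have : Nat.card H • (⟨x, hx⟩ : H) = 0 := card_nsmul_eq_zero'
  rw [hH] at this
  exact congrArg Subtype.val this

theorem AddSubgroup.exists_nsmul_eq_of_card {G : Type*} [AddCommGroup G] {H : AddSubgroup G} {n : ℕ}
    (hn : 0 < n) (hH : Nat.card H = n) {d : G} (hd : d ∈ H)
    (h : ∀ i, 0 < i → i < n → i • d ≠ 0) {x : G} (hx : x ∈ H) : ∃ i < n, i • d = x := by
  have hfin : Finite H := Nat.finite_of_card_ne_zero (by omega)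
  have hnd := AddSubgroup.nsmul_eq_zero_of_card hH hd
  have ho : addOrderOf d = n := by
    rw [addOrderOf_eq_iff hn]
    exact ⟨hnd, fun m h1 h2 => h m h2 h1⟩
  have hle : AddSubgroup.zmultiples d ≤ H := by simpa using hd
  have heq : AddSubgroup.zmultiples d = H := by
    apply AddSubgroup.eq_of_le_of_card_ge hle
    rw [Nat.card_zmultiples, ho, hH]
  rw [← heq] at hx
  obtain ⟨k, rfl⟩ := AddSubgroup.mem_zmultiples_iff.1 hx
  refine ⟨(k % n).toNat, ?_, ?_⟩
  · have := Int.emod_lt_of_pos k (by exact_mod_cast hn : (0:ℤ) < n)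
    have := Int.emod_nonneg k (by exact_mod_cast hn.ne' : (n:ℤ) ≠ 0)
    omega
  · have h1 := Int.emod_nonneg k (by exact_mod_cast hn.ne' : (n:ℤ) ≠ 0)
    rw [← natCast_zsmul, Int.toNat_of_nonneg h1, ← ho, mod_addOrderOf_zsmul]

/-- `(a, b)` is the pair of values of an extremal sequence `a^(n-1) b^(n-1)` over a subgroup `H` of
order `n`. -/
def IsExtremalPair {G : Type*} [AddCommGroup G] (H : AddSubgroup G) (n : ℕ) (a b : G) : Prop :=
  a ∈ H ∧ b ∈ H ∧ ¬ HasZeroSumSubseq n (Multiset.replicate (n - 1) a + Multiset.replicate (n - 1) b)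

namespace IsExtremalPair

variable {G : Type*} [AddCommGroup G] {H : AddSubgroup G} {n : ℕ} {a b : G}

theorem symm (h : IsExtremalPair H n a b) : IsExtremalPair H n b a :=
  ⟨h.2.1, h.1, by rw [add_comm]; exact h.2.2⟩

theorem ne (hn : 2 ≤ n) (hH : Nat.card H = n) (h : IsExtremalPair H n a b) : a ≠ b := by
  rintro rfl
  apply h.2.2
  refine ⟨Multiset.replicate n a, ?_, by simp, ?_⟩
  · rw [← Multiset.replicate_add]
    exact Multiset.replicate_mono _ (by omega)
  · rw [Multiset.sum_replicate, AddSubgroup.nsmul_eq_zero_of_card hH h.1]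

/-- The subsequence `a^i b^(n-i)` has sum `i(a - b)`, so `a - b` has order `n` and generates `H`.
Hence `(n-1)b + i(a - b)` runs through all of `H`. -/
theorem exists_eq (hn : 2 ≤ n) (hH : Nat.card H = n) (h : IsExtremalPair H n a b) {y : G}
    (hy : y ∈ H) : ∃ i < n, i • a + (n - 1 - i) • b = y := by
  have hb := AddSubgroup.nsmul_eq_zero_of_card hH h.2.1
  obtain ⟨i, hi, h1⟩ := AddSubgroup.exists_nsmul_eq_of_card (by omega) hH
    (H.sub_mem h.1 h.2.1) (x := y - (n - 1) • b) (fun i h0 hi h1 => by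
      apply h.2.2
      refine ⟨Multiset.replicate i a + Multiset.replicate (n - i) b, ?_, by simp; omega, ?_⟩
      · exact add_le_add (Multiset.replicate_mono _ (by omega))
          (Multiset.replicate_mono _ (by omega))
      · rw [Multiset.sum_replicate_add]
        have : n • b = (n - i) • b + i • b := by rw [← add_nsmul]; congr 1; omega
        rw [nsmul_sub] at h1
        rw [sub_eq_zero.1 h1, add_comm, ← this, hb])
    (H.sub_mem hy (H.nsmul_mem h.2.1 _))
  refine ⟨i, hi, ?_⟩
  have : (n - 1) • b = (n - 1 - i) • b + i • b := by rw [← add_nsmul]; congr 1; omega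
  rw [nsmul_sub, this] at h1
  have h2 := eq_sub_iff_add_eq.1 h1
  rw [← h2]; abel

theorem eq_of_pred_nsmul (hn : 2 ≤ n) (hH : Nat.card H = n) {x y : G} (hx : x ∈ H)
    (h : (n - 1) • x = - y) : y = x := by
  have := AddSubgroup.nsmul_eq_zero_of_card hH hx
  have h2 : n • x = (n - 1) • x + x := by rw [← succ_nsmul]; congr 1; omega
  rw [h2, h] at this
  exact (neg_add_eq_zero.1 this)

/-- If `R` contains `a^(n-2) b^(n-2)` and `-s` is not a sum of `n - 2` terms of `R`, then
`s = a + b`. -/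
theorem eq_add (hn : 2 ≤ n) (hH : Nat.card H = n) (h : IsExtremalPair H n a b) {s : G}
    (hs : s ∈ H) {R : Multiset G}
    (hR : Multiset.replicate (n - 2) a + Multiset.replicate (n - 2) b ≤ R)
    (hsR : ∀ U ≤ R, Multiset.card U = n - 2 → s + U.sum ≠ 0) : s = a + b := by
  -- Representing `-s + b` by `n - 1` terms lets one copy of `b` cancel, leaving `-s` as a forbidden
  -- sum of `n - 2` terms, unless `i = n - 1`.
  obtain ⟨i, hi, h1⟩ := h.exists_eq hn hH (H.add_mem (H.neg_mem hs) h.2.1)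
  rcases Nat.lt_or_ge i (n - 1) with h2 | h2
  · exfalso
    refine hsR (Multiset.replicate i a + Multiset.replicate (n - 2 - i) b)
      (le_trans (add_le_add (Multiset.replicate_mono _ (by omega))
          (Multiset.replicate_mono _ (by omega))) hR) (by simp; omega) ?_
    rw [Multiset.sum_replicate_add]
    have : (n - 1 - i) • b = (n - 2 - i) • b + b := by rw [← succ_nsmul]; congr 1; omega
    rw [this, ← add_assoc] at h1
    rw [add_right_cancel h1, add_neg_cancel]
  · obtain rfl : i = n - 1 := by omega
    rw [Nat.sub_self, zero_nsmul, add_zero] at h1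
    have := eq_of_pred_nsmul hn hH h.1 (y := s - b) (by rw [h1]; abel)
    rw [← this]; abel

/-- `-q` is a sum of `n - 1` terms `a` and `b`. These are available next to `q` unless all of them
are `a`, and then `-q = (n-1)a = -a`. -/
theorem swap_left (hn : 2 ≤ n) (hH : Nat.card H = n) (h : IsExtremalPair H n a b) {q : G}
    (hq : q ∈ H) (hqR : ¬ HasZeroSumSubseq n
      (q ::ₘ (Multiset.replicate (n - 2) a + Multiset.replicate (n - 1) b))) : q = a := by
  obtain ⟨i, hi, h1⟩ := h.exists_eq hn hH (H.neg_mem hq)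
  rcases Nat.lt_or_ge i (n - 1) with h2 | h2
  · exfalso
    apply hqR
    refine ⟨q ::ₘ (Multiset.replicate i a + Multiset.replicate (n - 1 - i) b),
      Multiset.cons_le_cons _ (add_le_add (Multiset.replicate_mono _ (by omega))
          (Multiset.replicate_mono _ (by omega))), by simp; omega, ?_⟩
    rw [Multiset.sum_cons, Multiset.sum_replicate_add, h1, add_neg_cancel]
  · obtain rfl : i = n - 1 := by omega
    rw [Nat.sub_self, zero_nsmul, add_zero] at h1
    exact eq_of_pred_nsmul hn hH h.1 h1

end IsExtremalPair

/-! ### The inverse property and its transfer to cyclic subgroups. -/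

/-- The inverse Erdős–Ginzburg–Ziv property of the cyclic group of order `n`. -/
def InverseEGZ (n : ℕ) : Prop :=
  ∀ P : Multiset (ZMod n), Multiset.card P + 2 = 2 * n → ¬ HasZeroSumSubseq n P →
    ∃ a b, P = Multiset.replicate (n - 1) a + Multiset.replicate (n - 1) b

theorem HasZeroSumSubseq.of_map {G K : Type*} [AddCommGroup G] [AddCommGroup K] (f : G →+ K)
    (hf : Function.Injective f) {k : ℕ} {S : Multiset G} (h : HasZeroSumSubseq k (S.map f)) :
    HasZeroSumSubseq k S := by
  obtain ⟨T, hT, h1, h2⟩ := h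
  obtain ⟨U, hU, rfl⟩ := Multiset.exists_le_map_eq hT
  refine ⟨U, hU, by simpa using h1, hf ?_⟩
  rw [map_multiset_sum, h2, map_zero]

theorem HasZeroSumSubseq.map {G K : Type*} [AddCommGroup G] [AddCommGroup K] (f : G →+ K)
    {k : ℕ} {S : Multiset G} (h : HasZeroSumSubseq k S) :
    HasZeroSumSubseq k (S.map f) := by
  obtain ⟨T, hT, h1, h2⟩ := h
  refine ⟨T.map f, Multiset.map_le_map hT, by simpa using h1, ?_⟩
  rw [← map_multiset_sum, h2, map_zero]

theorem AddSubgroup.exists_embedding_of_mem {G : Type*} [AddCommGroup G] {H : AddSubgroup G}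
    [IsAddCyclic H] {n : ℕ} (hH : Nat.card H = n) {P : Multiset G} (hP : ∀ x ∈ P, x ∈ H) :
    ∃ (f : ZMod n →+ G) (Q : Multiset (ZMod n)), Function.Injective f ∧ Q.map f = P := by
  subst hH
  obtain ⟨Q, rfl⟩ : ∃ Q : Multiset H, Q.map H.subtype = P := by
    lift P to Multiset H using hP
    exact ⟨P, rfl⟩
  let e := zmodAddCyclicAddEquiv (G := H) inferInstance
  refine ⟨H.subtype.comp e.toAddMonoidHom, Q.map e.symm,
    H.subtype_injective.comp e.injective, ?_⟩
  rw [Multiset.map_map]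
  exact Multiset.map_congr rfl fun x _ => by simp

theorem AddSubgroup.hasZeroSumSubseq_of_card {G : Type*} [AddCommGroup G] {H : AddSubgroup G}
    [IsAddCyclic H] {n : ℕ} (hH : Nat.card H = n) {P : Multiset G} (hP : ∀ x ∈ P, x ∈ H)
    (hc : 2 * n - 1 ≤ Multiset.card P) : HasZeroSumSubseq n P := by
  obtain ⟨f, Q, hf, rfl⟩ := AddSubgroup.exists_embedding_of_mem hH hP
  exact HasZeroSumSubseq.map f (ZMod.erdos_ginzburg_ziv_multiset Q (by simpa using hc))

/-- The extremal sequences over a cyclic subgroup. -/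
theorem InverseEGZ.exists_pair {n : ℕ} (h : InverseEGZ n) {G : Type*} [AddCommGroup G]
    {H : AddSubgroup G} [IsAddCyclic H] (hn : 2 ≤ n) (hH : Nat.card H = n) {P : Multiset G}
    (hP : ∀ x ∈ P, x ∈ H) (hc : Multiset.card P + 2 = 2 * n) (hz : ¬ HasZeroSumSubseq n P) :
    ∃ a b, IsExtremalPair H n a b ∧
      P = Multiset.replicate (n - 1) a + Multiset.replicate (n - 1) b := by
  obtain ⟨f, Q, hf, rfl⟩ := AddSubgroup.exists_embedding_of_mem hH hP
  obtain ⟨a, b, rfl⟩ := h Q (by simpa using hc) fun h => hz (h.map f)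
  refine ⟨f a, f b, ⟨?_, ?_, by simpa using hz⟩, by simp⟩
  · exact hP _ (Multiset.mem_map_of_mem _
      (Multiset.mem_add.2 (.inl (Multiset.mem_replicate.2 ⟨by omega, rfl⟩))))
  · exact hP _ (Multiset.mem_map_of_mem _
      (Multiset.mem_add.2 (.inr (Multiset.mem_replicate.2 ⟨by omega, rfl⟩))))

/-- An extremal sequence is determined by all but one of its terms. -/
theorem InverseEGZ.eq_of_cons {n : ℕ} (h : InverseEGZ n) {G : Type*} [AddCommGroup G]
    {H : AddSubgroup G} [IsAddCyclic H] (hn : 2 ≤ n) (hH : Nat.card H = n) {R : Multiset G} {t q : G}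
    (hP : ∀ x ∈ t ::ₘ R, x ∈ H) (hc : Multiset.card R + 3 = 2 * n)
    (hz : ¬ HasZeroSumSubseq n (t ::ₘ R)) (hq : q ∈ H) (hzq : ¬ HasZeroSumSubseq n (q ::ₘ R)) :
    q = t := by
  have key : ∀ {a b : G}, IsExtremalPair H n a b →
      t ::ₘ R = Multiset.replicate (n - 1) a + Multiset.replicate (n - 1) b → t = a → q = t := by
    rintro a b hab hR rfl
    refine hab.swap_left hn hH hq ?_
    have h1 : n - 1 = n - 2 + 1 := by omega
    nth_rewrite 1 [h1] at hR
    rw [Multiset.replicate_succ, Multiset.cons_add, Multiset.cons_inj_right] at hR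
    rwa [← hR]
  obtain ⟨a, b, hab, hR⟩ := h.exists_pair hn hH hP (by simp; omega) hz
  have ht : t ∈ Multiset.replicate (n - 1) a + Multiset.replicate (n - 1) b := by
    rw [← hR]; simp
  rcases Multiset.mem_add.1 ht with h1 | h1
  · exact key hab hR (Multiset.eq_of_mem_replicate h1)
  · exact key hab.symm (by rw [hR, add_comm]) (Multiset.eq_of_mem_replicate h1)

/-! ### The inverse theorem for prime order. -/

open Classical in
/-- The set of sums of subsequences of length `k`. -/
noncomputable def subsums {G : Type*} [AddCommGroup G] (k : ℕ) (S : Multiset G) : Finset G :=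
  ((S.powersetCard k).map Multiset.sum).toFinset

theorem mem_subsums {G : Type*} [AddCommGroup G] {k : ℕ} {S : Multiset G} {x : G} :
    x ∈ subsums k S ↔ ∃ T ≤ S, Multiset.card T = k ∧ T.sum = x := by
  simp [subsums, Multiset.mem_powersetCard, and_assoc]

open Pointwise in
-- Induction on `k`. If no multiplicity exceeds `k`, fix one term and choose the others from the
-- rest. Otherwise split off the set `A` of distinct terms: some multiplicity is exactly `k + 1`, so
-- at least `k` terms remain, and Cauchy–Davenport applies to `A` and their `k`-sums.
theorem card_subsums_ge {p : ℕ} (hp : p.Prime) (k : ℕ) (S : Multiset (ZMod p))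
    (hS : ∀ x, S.count x ≤ k) (hk : k ≤ Multiset.card S) :
    min p (Multiset.card S - k + 1) ≤ (subsums k S).card := by
  induction k generalizing S with
  | zero =>
    have : S = 0 := by
      refine Multiset.eq_zero_of_forall_notMem fun x hx => ?_
      have := Multiset.count_pos.2 hx
      have := hS x
      omega
    subst this
    have h0 : (0 : ZMod p) ∈ subsums 0 (0 : Multiset (ZMod p)) := mem_subsums.2 ⟨0, by simp⟩
    have := Finset.card_pos.2 ⟨_, h0⟩
    exact (min_le_right _ _).trans (by simpa using this)
  | succ k ih =>
    by_cases h : ∀ x, S.count x ≤ k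
    · obtain ⟨e, he⟩ := Multiset.card_pos_iff_exists_mem.1 (show 0 < Multiset.card S by omega)
      obtain ⟨S', rfl⟩ := Multiset.exists_cons_of_mem he
      rw [Multiset.card_cons] at hk ⊢
      refine le_trans ?_ ((ih S' (fun x => (Multiset.count_le_count_cons _ _ _).trans (h x))
        (by omega)).trans ?_)
      · apply min_le_min_left; omega
      · apply Finset.card_le_card_of_injOn (fun x => e + x) _ (by simp)
        intro x hx
        obtain ⟨T, hT, h1, h2⟩ := mem_subsums.1 hx
        exact mem_subsums.2 ⟨e ::ₘ T, Multiset.cons_le_cons _ hT, by simp [h1], by simp [h2]⟩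
    · push Not at h
      obtain ⟨g, hg⟩ := h
      set A := S.toFinset with hA
      have hAS : A.val ≤ S := by
        rw [hA, Multiset.toFinset_val]; exact Multiset.dedup_le S
      obtain ⟨S', hS'⟩ := Multiset.le_iff_exists_add.1 hAS
      have hcnt : ∀ x, x ∈ S → S.count x = 1 + S'.count x := fun x hx => by
        conv_lhs => rw [hS']
        rw [Multiset.count_add, Multiset.count_eq_one_of_mem A.nodup (by simpa [hA] using hx)]
      have hc : Multiset.card S = A.card + Multiset.card S' := by
        conv_lhs => rw [hS']
        simp
      have hgS : g ∈ S := Multiset.count_pos.1 (by omega)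
      have hkS' : k ≤ Multiset.card S' := by
        have := hcnt g hgS
        have := Multiset.count_le_card g S'
        omega
      have ih' := ih S' (fun x => by
        by_cases hx : x ∈ S
        · have := hcnt x hx; have := hS x; omega
        · rw [Multiset.count_eq_zero_of_notMem]
          · omega
          · exact fun h => hx (by rw [hS']; exact Multiset.mem_add.2 (.inr h))) hkS'
      have hne : (subsums k S').Nonempty := by
        rw [← Finset.card_pos]
        exact lt_of_lt_of_le (lt_min hp.pos (Nat.succ_pos _)) ih'
      have hAne : A.Nonempty := ⟨g, by simpa [hA] using hgS⟩
      have cd := ZMod.cauchy_davenport hp hAne hne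
      have hsub : A + subsums k S' ⊆ subsums (k + 1) S := by
        intro x hx
        obtain ⟨a, ha, y, hy, rfl⟩ := Finset.mem_add.1 hx
        obtain ⟨T, hT, h1, h2⟩ := mem_subsums.1 hy
        refine mem_subsums.2 ⟨a ::ₘ T, ?_, by simp [h1], by simp [h2]⟩
        rw [hS', ← Multiset.singleton_add]
        exact add_le_add (Multiset.singleton_le.2 ha) hT
      have := Finset.card_le_card hsub
      have := hAne.card_pos
      omega

/-- A zero-sum free sequence of length `n - 1` over a group of order `n` is constant. -/
theorem eq_of_zeroSumFree {G : Type*} [AddCommGroup G] {n : ℕ} (hG : Nat.card G = n)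
    {T : Multiset G} (hT : Multiset.card T + 1 = n) (h : ∀ U ≤ T, U ≠ 0 → U.sum ≠ 0) {x y : G}
    {T' : Multiset G} (hxy : T = x ::ₘ y ::ₘ T') : x = y := by
  obtain ⟨l', rfl⟩ : ∃ l' : List G, T' = l' := ⟨T'.toList, by simp⟩
  set l := x :: y :: l' with hl
  have hTl : T = (l : Multiset G) := by rw [hxy]; rfl
  have hlen : l.length + 1 = n := by rw [← hT, hTl]; simp
  have hsub : ∀ u : List G, u.Sublist l → u ≠ [] → u.sum ≠ 0 := fun u hu h0 => by
    have := h (u : Multiset G) (by rw [hTl]; exact hu.subperm) (by simpa using h0)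
    simpa using this
  have hfin : Finite G := Nat.finite_of_card_ne_zero (by omega)
  -- The `n` initial partial sums are distinct, so they exhaust `G` and one of them equals `y`.
  -- Index 0 gives `y = 0`, index 1 gives `x = y`, and a larger index gives, after cancelling `y`, a
  -- zero-sum subsequence containing `x`.
  let f : Fin n → G := fun k => (l.take k).sum
  have hlt : ∀ j k : Fin n, j < k → f j ≠ f k := by
    intro j k hjk he
    have h1 : l.take k = l.take j ++ (l.take k).drop j := by
      conv_lhs => rw [← List.take_append_drop j (l.take k), List.take_take]
      rw [min_eq_left (by exact_mod_cast hjk.le)]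
    refine hsub ((l.take k).drop j) ((List.drop_sublist _ _).trans (List.take_sublist _ _)) ?_ ?_
    · intro h2
      have := congrArg List.length h2
      simp at this
      have := k.2
      have : (j : ℕ) < k := hjk
      omega
    · have h3 : f k = f j + ((l.take k).drop j).sum := by
        simp only [f]; conv_lhs => rw [h1, List.sum_append]
      rw [he] at h3
      simpa using h3.symm
  have hinj : Function.Injective f := fun j k he => by
    rcases lt_trichotomy j k with h1 | h1 | h1
    · exact absurd he (hlt _ _ h1)
    · exact h1
    · exact absurd he.symm (hlt _ _ h1)
  obtain ⟨k, hk⟩ := (hinj.bijective_of_nat_card_le (by simp [hG])).2 y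
  obtain ⟨k, hkn⟩ := k
  simp only [f, hl] at hk
  match k with
  | 0 => exact absurd (by simpa using hk.symm) (hsub [y] (by simp [hl]) (by simp))
  | 1 => simpa using hk
  | k + 2 =>
    simp only [List.take_succ_cons, List.sum_cons] at hk
    refine absurd ?_ (hsub (x :: l'.take k) ?_ (by simp))
    · rw [List.sum_cons]
      have : x + (l'.take k).sum + y = 0 + y := by rw [zero_add]; nth_rewrite 2 [← hk]; abel
      exact add_right_cancel this
    · exact List.Sublist.cons_cons _ ((List.take_sublist _ _).trans (List.sublist_cons_self _ _))

/-- If all multiplicities are at most `p - 2`, the sums of `p - 2` terms fill `ZMod p`; removing `p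
- 2` terms with the sum of the whole sequence leaves `p` terms with sum zero. So some `a` occurs `p
- 1` times, and the other `p - 1` terms, translated by `-a`, form a zero-sum free sequence, hence a
constant one. -/
theorem inverseEGZ_prime {p : ℕ} (hp : p.Prime) : InverseEGZ p := by
  intro S hS hz
  have : NeZero p := ⟨hp.ne_zero⟩
  have h2 := hp.two_le
  obtain ⟨a, ha⟩ : ∃ a, p - 1 ≤ S.count a := by
    by_contra! h
    have h3 := card_subsums_ge hp (p - 2) S (fun x => by have := h x; omega) (by omega)
    have h4 : subsums (p - 2) S = Finset.univ := by
      rw [← Finset.card_eq_iff_eq_univ, ZMod.card]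
      have := Finset.card_le_univ (subsums (p - 2) S)
      rw [ZMod.card] at this
      omega
    obtain ⟨T, hT, h5, h6⟩ := mem_subsums.1 (h4 ▸ Finset.mem_univ S.sum)
    obtain ⟨U, rfl⟩ := Multiset.le_iff_exists_add.1 hT
    refine hz ⟨U, Multiset.le_add_left _ _, ?_, by simpa using h6⟩
    rw [Multiset.card_add] at hS
    omega
  obtain ⟨T, rfl⟩ := Multiset.le_iff_exists_add.1 (Multiset.le_count_iff_replicate_le.1 ha)
  rw [Multiset.card_add, Multiset.card_replicate] at hS
  have hT : Multiset.card T + 1 = p := by omega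
  suffices h : ∀ x ∈ T, ∀ y ∈ T, x = y by
    obtain ⟨b, hb⟩ := Multiset.card_pos_iff_exists_mem.1 (show 0 < Multiset.card T by omega)
    refine ⟨a, b, ?_⟩
    rw [Multiset.eq_replicate.2 ⟨(by omega : Multiset.card T = p - 1), fun x hx => h x hx b hb⟩]
  intro x hx y hy
  by_contra hne
  obtain ⟨T', rfl⟩ := Multiset.exists_cons_of_mem hx
  obtain ⟨T'', rfl⟩ := Multiset.exists_cons_of_mem
    ((Multiset.mem_cons.1 hy).resolve_left (Ne.symm hne))
  have := eq_of_zeroSumFree (n := p) (G := ZMod p) (by simp)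
    (T := (x ::ₘ y ::ₘ T'').map (fun t => t - a)) (by simpa using hT) (fun U hU hU0 hUs => by
      obtain ⟨V, hV, rfl⟩ := Multiset.exists_le_map_eq hU
      have hVc : 0 < Multiset.card V := Multiset.card_pos.2 (by rintro rfl; simp at hU0)
      have hVle := Multiset.card_le_card hV
      rw [Multiset.sum_map_sub, Multiset.map_id', Multiset.map_const', Multiset.sum_replicate] at hUs
      refine hz ⟨Multiset.replicate (p - Multiset.card V) a + V,
        add_le_add (Multiset.replicate_mono _ (by omega)) hV, by simp; omega, ?_⟩
      rw [Multiset.sum_add, Multiset.sum_replicate, sub_eq_zero.1 hUs, ← add_nsmul,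
        Nat.sub_add_cancel (by omega)]
      simp) (x := x - a) (y := y - a) (by rw [Multiset.map_cons, Multiset.map_cons])
  exact hne (sub_left_injective this)

/-! ### The inverse theorem for composite order, by reduction modulo a prime. -/

theorem Multiset.eq_replicate_add_replicate {α : Type*} {a b : α} {S : Multiset α}
    (h : ∀ x ∈ S, x = a ∨ x = b) : ∃ i ≤ Multiset.card S,
      S = Multiset.replicate i a + Multiset.replicate (Multiset.card S - i) b := by
  induction S using Multiset.induction_on with
  | empty => exact ⟨0, by simp⟩
  | cons x S ih =>
    obtain ⟨i, hi, h1⟩ := ih fun y hy => h y (Multiset.mem_cons_of_mem hy)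
    rcases h x (Multiset.mem_cons_self _ _) with rfl | rfl
    · refine ⟨i + 1, by simpa using hi, ?_⟩
      rw [Multiset.replicate_succ, Multiset.cons_add, Multiset.card_cons, Nat.add_sub_add_right,
        ← h1]
    · refine ⟨i, by simpa using hi.trans (Nat.le_succ _), ?_⟩
      rw [Multiset.card_cons, Nat.sub_add_comm hi, Multiset.replicate_succ, Multiset.add_cons, ← h1]

theorem IsExtremalPair.count_eq {G : Type*} [AddCommGroup G] [DecidableEq G] {H : AddSubgroup G}
    {n : ℕ} {a b : G} (hn : 2 ≤ n) (hH : Nat.card H = n) (h : IsExtremalPair H n a b) {x : G}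
    (hx : x ∈ Multiset.replicate (n - 1) a + Multiset.replicate (n - 1) b) :
    (Multiset.replicate (n - 1) a + Multiset.replicate (n - 1) b).count x = n - 1 := by
  have hne := h.ne hn hH
  rcases Multiset.mem_add.1 hx with h1 | h1 <;> obtain rfl := Multiset.eq_of_mem_replicate h1 <;>
    simp [Multiset.count_replicate, hne, hne.symm]

/-- A decomposition of `S` into `k` blocks of length `p` with sum in the kernel of `φ`, and a
remainder `R`. -/
def IsBlockDecomp {G K : Type*} [AddCommGroup G] [AddCommGroup K] (φ : G →+ K) (p k : ℕ)
    (S : Multiset G) (B : Multiset (Multiset G)) (R : Multiset G) : Prop :=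
  S = B.join + R ∧ (∀ b ∈ B, Multiset.card b = p ∧ φ b.sum = 0) ∧ Multiset.card B = k

namespace IsBlockDecomp

variable {G : Type*} [AddCommGroup G] {p m k : ℕ} {φ : G →+ ZMod p} {S R : Multiset G}
  {B : Multiset (Multiset G)}

theorem exists_decomp (hp : 0 < p) (φ : G →+ ZMod p) (k : ℕ) (S : Multiset G)
    (hS : (k + 1) * p ≤ Multiset.card S + 1) : ∃ B R, IsBlockDecomp φ p k S B R := by
  induction k generalizing S with
  | zero => exact ⟨0, S, by simp, by simp, rfl⟩
  | succ k ih =>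
    obtain ⟨T, hT, h1, h2⟩ : HasZeroSumSubseq p (S.map φ) :=
      ZMod.erdos_ginzburg_ziv_multiset _ (by
        rw [Multiset.card_map]
        have : (k + 1 + 1) * p = k * p + 2 * p := by ring
        omega)
    obtain ⟨b, hb, rfl⟩ := Multiset.exists_le_map_eq hT
    obtain ⟨S', rfl⟩ := Multiset.le_iff_exists_add.1 hb
    rw [Multiset.card_map] at h1
    obtain ⟨B, R, h3, h4, h5⟩ := ih S' (by
      rw [Multiset.card_add, h1] at hS
      have : (k + 1 + 1) * p = (k + 1) * p + p := by ring
      omega)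
    refine ⟨b ::ₘ B, R, by rw [h3, Multiset.join_cons, add_assoc], ?_, by simp [h5]⟩
    intro c hc
    rcases Multiset.mem_cons.1 hc with rfl | hc
    · exact ⟨h1, by rw [map_multiset_sum, h2]⟩
    · exact h4 c hc

theorem mem_ker (h : IsBlockDecomp φ p k S B R) : ∀ x ∈ B.map Multiset.sum, x ∈ φ.ker := by
  intro x hx
  obtain ⟨b, hb, rfl⟩ := Multiset.mem_map.1 hx
  exact (h.2.1 b hb).2

theorem not_hasZeroSumSubseq (h : IsBlockDecomp φ p k S B R)
    (hz : ¬ HasZeroSumSubseq (p * m) S) : ¬ HasZeroSumSubseq m (B.map Multiset.sum) :=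
  fun h' => hz (h'.of_blocks (fun b hb => (h.2.1 b hb).1)
    (by rw [h.1]; exact Multiset.le_add_right _ _) (mul_comm _ _))

/-- A further block would give `2m - 1` block sums in the cyclic kernel of order `m`, and
Erdős–Ginzburg–Ziv applies to them. -/
theorem remainder_not_hasZeroSumSubseq [IsAddCyclic φ.ker] (hker : Nat.card φ.ker = m)
    (hm : 2 ≤ m) (h : IsBlockDecomp φ p (2 * m - 2) S B R) (hz : ¬ HasZeroSumSubseq (p * m) S) :
    ¬ HasZeroSumSubseq p (R.map φ) := by
  rintro ⟨T, hT, h1, h2⟩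
  obtain ⟨b, hb, rfl⟩ := Multiset.exists_le_map_eq hT
  obtain ⟨R', rfl⟩ := Multiset.le_iff_exists_add.1 hb
  have h' : IsBlockDecomp φ p (2 * m - 2 + 1) S (b ::ₘ B) R' := by
    refine ⟨by rw [h.1, Multiset.join_cons]; abel, ?_, by rw [Multiset.card_cons, h.2.2]⟩
    intro c hc
    rcases Multiset.mem_cons.1 hc with rfl | hc
    · exact ⟨by simpa using h1, by rw [map_multiset_sum, h2]⟩
    · exact h.2.1 c hc
  refine h'.not_hasZeroSumSubseq hz (AddSubgroup.hasZeroSumSubseq_of_card hker h'.mem_ker ?_)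
  rw [Multiset.card_map, h'.2.2]
  omega

theorem card_remainder (h : IsBlockDecomp φ p k S B R) :
    Multiset.card S = k * p + Multiset.card R := by
  rw [h.1, Multiset.card_add, Multiset.card_join_of_forall fun b hb => (h.2.1 b hb).1, h.2.2]

end IsBlockDecomp

theorem AddSubgroup.card_top_zmod (p : ℕ) : Nat.card (⊤ : AddSubgroup (ZMod p)) = p := by
  rw [AddSubgroup.card_top, Nat.card_zmod]

section Composite

variable {G : Type*} [AddCommGroup G] {p m : ℕ} {φ : G →+ ZMod p} {S R : Multiset G}
  {B : Multiset (Multiset G)} {a b : ZMod p}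

theorem IsBlockDecomp.exists_pair [IsAddCyclic φ.ker] (hp : p.Prime) (hm : 2 ≤ m)
    (hker : Nat.card φ.ker = m) (h : IsBlockDecomp φ p (2 * m - 2) S B R)
    (hS : Multiset.card S + 2 = 2 * (p * m)) (hz : ¬ HasZeroSumSubseq (p * m) S) :
    ∃ a b, IsExtremalPair ⊤ p a b ∧
      R.map φ = Multiset.replicate (p - 1) a + Multiset.replicate (p - 1) b := by
  have hn := h.remainder_not_hasZeroSumSubseq hker hm hz
  have hc := h.card_remainder
  refine (inverseEGZ_prime hp).exists_pair hp.two_le (AddSubgroup.card_top_zmod p)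
    (fun _ _ => AddSubgroup.mem_top _) ?_ hn
  obtain ⟨m, rfl⟩ := Nat.exists_eq_add_of_le hm
  have h1 : 2 * (2 + m) - 2 = 2 * (m + 1) := by omega
  rw [h1] at hc
  rw [Multiset.card_map]
  nlinarith

/-- In an extremal situation, the terms of every block take only the two values occurring in the
remainder. -/
theorem IsBlockDecomp.eq_or_eq_of_mem [IsAddCyclic φ.ker] (hp : p.Prime) (hm : 2 ≤ m)
    (hker : Nat.card φ.ker = m) (h : IsBlockDecomp φ p (2 * m - 2) S B R)
    (hS : Multiset.card S + 2 = 2 * (p * m)) (hz : ¬ HasZeroSumSubseq (p * m) S)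
    (hab : IsExtremalPair ⊤ p a b)
    (hR : R.map φ = Multiset.replicate (p - 1) a + Multiset.replicate (p - 1) b)
    {C : Multiset G} (hC : C ∈ B) {x : ZMod p} (hx : x ∈ C.map φ) : x = a ∨ x = b := by
  have hp2 := hp.two_le
  have htop := AddSubgroup.card_top_zmod p
  have hne := hab.ne hp2 htop
  by_contra! hxab
  obtain ⟨B', rfl⟩ := Multiset.exists_cons_of_mem hC
  obtain ⟨β, hβ⟩ := Multiset.exists_cons_of_mem hx
  -- Any zero-sum block `W` taken from `R` and `C` together may replace `C`, so the new remainder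
  -- `Q` is again extremal.
  have hex : ∀ W Q : Multiset (ZMod p), W + Q = (R + C).map φ → Multiset.card W = p → W.sum = 0 →
      ∃ c d, IsExtremalPair ⊤ p c d ∧
        Q = Multiset.replicate (p - 1) c + Multiset.replicate (p - 1) d := by
    intro W Q hWQ hW hW0
    obtain ⟨D, hD, rfl⟩ := Multiset.exists_le_map_eq
      (show W ≤ (R + C).map φ from hWQ ▸ Multiset.le_add_right _ _)
    obtain ⟨E, hE⟩ := Multiset.le_iff_exists_add.1 hD
    rw [hE, Multiset.map_add] at hWQ
    obtain rfl := add_left_cancel hWQ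
    have h' : IsBlockDecomp φ p (2 * m - 2) S (D ::ₘ B') E := by
      refine ⟨?_, ?_, by rw [← h.2.2]; simp⟩
      · rw [h.1, Multiset.join_cons, Multiset.join_cons]
        calc C + B'.join + R = B'.join + (R + C) := by abel
          _ = _ := by rw [hE]; abel
      · intro c hc
        rcases Multiset.mem_cons.1 hc with rfl | hc
        · exact ⟨by simpa using hW, by rw [map_multiset_sum, hW0]⟩
        · exact h.2.1 c (Multiset.mem_cons_of_mem hc)
    exact h'.exists_pair hp hm hker hS hz
  obtain ⟨i, hi, hix⟩ := hab.exists_eq hp2 htop (AddSubgroup.mem_top (-x))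
  have hi0 : i ≠ 0 := by
    rintro rfl
    rw [zero_nsmul, zero_add, Nat.sub_zero] at hix
    exact hxab.2 (IsExtremalPair.eq_of_pred_nsmul hp2 htop (AddSubgroup.mem_top _) hix)
  have hi1 : i ≠ p - 1 := by
    rintro rfl
    rw [Nat.sub_self, zero_nsmul, add_zero] at hix
    exact hxab.1 (IsExtremalPair.eq_of_pred_nsmul hp2 htop (AddSubgroup.mem_top _) hix)
  obtain ⟨j, hj⟩ : ∃ j, p - 1 = i + j := ⟨p - 1 - i, by omega⟩
  have hj' : p - 1 - i = j := by omega
  rw [hj'] at hix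
  have hU : (R + C).map φ = x ::ₘ (Multiset.replicate (i + j) a + Multiset.replicate (i + j) b + β) := by
    rw [Multiset.map_add, hR, hβ, Multiset.add_cons, hj]
  -- The block `x a^i b^j` leaves `a^j b^i β`, where `a` and `b` must each occur `p - 1 = i + j`
  -- times; so `β` contains `a` exactly `i` times and `b` exactly `j` times, both positive.
  obtain ⟨c, d, hcd, hQ⟩ := hex (x ::ₘ (Multiset.replicate i a + Multiset.replicate j b))
    (Multiset.replicate j a + Multiset.replicate i b + β)
    (by rw [hU, Multiset.replicate_add, Multiset.replicate_add, Multiset.cons_add]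
        congr 1; abel)
    (by simp; omega)
    (by rw [Multiset.sum_cons, Multiset.sum_replicate_add, hix, add_neg_cancel])
  have hca := hcd.count_eq hp2 htop (x := a) (by
    rw [← hQ]; exact Multiset.mem_add.2 (.inl (Multiset.mem_add.2 (.inl
      (Multiset.mem_replicate.2 ⟨by omega, rfl⟩)))))
  have hcb := hcd.count_eq hp2 htop (x := b) (by
    rw [← hQ]; exact Multiset.mem_add.2 (.inl (Multiset.mem_add.2 (.inr
      (Multiset.mem_replicate.2 ⟨by omega, rfl⟩)))))
  rw [← hQ] at hca hcb
  simp only [Multiset.count_add, Multiset.count_replicate, hne, hne.symm, if_true, if_false]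
    at hca hcb
  obtain ⟨β', hβ'⟩ := Multiset.exists_cons_of_mem
    (Multiset.count_pos.1 (show 0 < β.count a by omega))
  -- The block `a^p` leaves a remainder in which `b` occurs `(p - 1) + j` times, which is too often.
  obtain ⟨c, d, hcd, hQ⟩ := hex (Multiset.replicate p a)
    (x ::ₘ (Multiset.replicate (i + j) b + β'))
    (by
      obtain ⟨q, rfl⟩ : ∃ q, p = q + 1 := ⟨p - 1, by omega⟩
      rw [hU, hβ', ← hj, Nat.add_sub_cancel, Multiset.replicate_succ, Multiset.add_cons,
        Multiset.cons_add, Multiset.add_cons, add_assoc])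
    (by simp) (by simp)
  have hcb' := hcd.count_eq hp2 htop (x := b) (by
    rw [← hQ]; exact Multiset.mem_cons_of_mem (Multiset.mem_add.2 (.inl
      (Multiset.mem_replicate.2 ⟨by omega, rfl⟩))))
  rw [← hQ] at hcb'
  rw [hβ', Multiset.count_cons_of_ne hne.symm] at hcb
  rw [Multiset.count_cons_of_ne hxab.2.symm, Multiset.count_add, Multiset.count_replicate_self] at hcb'
  omega

/-- In an extremal situation, every block is constant modulo the kernel. -/
theorem IsBlockDecomp.map_eq_replicate [IsAddCyclic φ.ker] (hp : p.Prime) (hm : 2 ≤ m)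
    (hker : Nat.card φ.ker = m) (h : IsBlockDecomp φ p (2 * m - 2) S B R)
    (hS : Multiset.card S + 2 = 2 * (p * m)) (hz : ¬ HasZeroSumSubseq (p * m) S)
    (hab : IsExtremalPair ⊤ p a b)
    (hR : R.map φ = Multiset.replicate (p - 1) a + Multiset.replicate (p - 1) b)
    {C : Multiset G} (hC : C ∈ B) : (∀ x ∈ C, φ x = a) ∨ (∀ x ∈ C, φ x = b) := by
  obtain ⟨i, hi, h1⟩ := Multiset.eq_replicate_add_replicate fun x hx =>
    h.eq_or_eq_of_mem hp hm hker hS hz hab hR hC (x := x) hx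
  obtain ⟨hCp, hC0⟩ := h.2.1 C hC
  rw [Multiset.card_map, hCp] at h1 hi
  by_cases h0 : i = 0
  · subst h0
    refine .inr fun x hx => ?_
    have := Multiset.mem_map_of_mem φ hx
    rw [h1] at this
    exact Multiset.eq_of_mem_replicate (by simpa using this)
  by_cases h2 : i = p
  · subst h2
    refine .inl fun x hx => ?_
    have := Multiset.mem_map_of_mem φ hx
    rw [h1] at this
    rw [Nat.sub_self, Multiset.replicate_zero, add_zero] at this
    exact Multiset.eq_of_mem_replicate this
  -- A block with both values is a zero-sum subsequence of `a^(p-1) b^(p-1)`.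
  exfalso
  apply hab.2.2
  refine ⟨C.map φ, ?_, by simpa using hCp, by rw [← map_multiset_sum, hC0]⟩
  rw [h1]
  exact add_le_add (Multiset.replicate_mono _ (by omega)) (Multiset.replicate_mono _ (by omega))

/-- Terms of blocks agree with the terms of the remainder in the same residue class. -/
theorem IsBlockDecomp.eq_of_map_eq [IsAddCyclic φ.ker] (hm : 2 ≤ m)
    (hI : InverseEGZ m) (hker : Nat.card φ.ker = m) (h : IsBlockDecomp φ p (2 * m - 2) S B R)
    (hz : ¬ HasZeroSumSubseq (p * m) S)
    {C : Multiset G} (hC : C ∈ B) {x r : G} (hx : x ∈ C) (hr : r ∈ R) (hxr : φ x = φ r) :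
    x = r := by
  obtain ⟨B', rfl⟩ := Multiset.exists_cons_of_mem hC
  obtain ⟨C', rfl⟩ := Multiset.exists_cons_of_mem hx
  obtain ⟨R', rfl⟩ := Multiset.exists_cons_of_mem hr
  obtain ⟨hCp, hC0⟩ := h.2.1 _ hC
  -- Exchanging `x` and `r` alters a single block sum, while an extremal sequence is determined by
  -- all but one of its terms.
  have h' : IsBlockDecomp φ p (2 * m - 2) S ((r ::ₘ C') ::ₘ B') (x ::ₘ R') := by
    refine ⟨?_, ?_, by rw [← h.2.2]; simp⟩
    · rw [h.1, Multiset.join_cons, Multiset.join_cons]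
      simp only [← Multiset.singleton_add]
      abel
    · intro c hc
      rcases Multiset.mem_cons.1 hc with rfl | hc
      · refine ⟨by simpa using hCp, ?_⟩
        rw [Multiset.sum_cons, map_add, ← hxr, ← map_add, ← Multiset.sum_cons, hC0]
      · exact h.2.1 c (Multiset.mem_cons_of_mem hc)
  have hk := h.mem_ker
  have hz1 := h.not_hasZeroSumSubseq hz
  have hk' := h'.mem_ker
  have hz1' := h'.not_hasZeroSumSubseq hz
  rw [Multiset.map_cons] at hk hz1 hk' hz1'
  have hB' : Multiset.card (B'.map Multiset.sum) + 3 = 2 * m := by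
    have := h.2.2
    rw [Multiset.card_cons] at this
    rw [Multiset.card_map]
    omega
  have := hI.eq_of_cons hm hker hk' hB' hz1' (hk _ (Multiset.mem_cons_self _ _)) hz1
  rw [Multiset.sum_cons, Multiset.sum_cons] at this
  exact add_right_cancel this

theorem IsBlockDecomp.exists_forall_eq [IsAddCyclic φ.ker] (hp : p.Prime) (hm : 2 ≤ m)
    (hI : InverseEGZ m) (hker : Nat.card φ.ker = m) (h : IsBlockDecomp φ p (2 * m - 2) S B R)
    (hS : Multiset.card S + 2 = 2 * (p * m)) (hz : ¬ HasZeroSumSubseq (p * m) S)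
    (hab : IsExtremalPair ⊤ p a b)
    (hR : R.map φ = Multiset.replicate (p - 1) a + Multiset.replicate (p - 1) b) :
    ∃ x₀, ∀ x ∈ S, φ x = a → x = x₀ := by
  have hp2 := hp.two_le
  have hmem : ∀ c ∈ R.map φ, ∃ r ∈ R, φ r = c := fun c hc => Multiset.mem_map.1 hc
  obtain ⟨r, hrR, hr⟩ := hmem a (by
    rw [hR]; exact Multiset.mem_add.2 (.inl (Multiset.mem_replicate.2 ⟨by omega, rfl⟩)))
  obtain ⟨s, hsR, hs⟩ := hmem b (by
    rw [hR]; exact Multiset.mem_add.2 (.inr (Multiset.mem_replicate.2 ⟨by omega, rfl⟩)))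
  -- Terms of the remainder can only be compared through a block in their class. If no block lay in
  -- class `a`, all `2m - 2` block sums would equal `p • s`, and `m` of them would have sum zero.
  obtain ⟨C, hC, hCa⟩ : ∃ C ∈ B, ∀ x ∈ C, φ x = a := by
    by_contra! hno
    have hall : ∀ C ∈ B, C.sum = p • s := by
      intro C hC
      have hCb := (h.map_eq_replicate hp hm hker hS hz hab hR hC).resolve_left
        (fun h' => by obtain ⟨x, hx, hxa⟩ := hno C hC; exact hxa (h' x hx))
      rw [Multiset.eq_replicate.2 ⟨(h.2.1 C hC).1, fun x hx =>
        h.eq_of_map_eq hm hI hker hz hC hx hsR (by rw [hCb x hx, hs])⟩, Multiset.sum_replicate]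
    apply h.not_hasZeroSumSubseq hz
    refine ⟨Multiset.replicate m (p • s), ?_, by simp, ?_⟩
    · rw [Multiset.map_congr rfl hall, Multiset.map_const', h.2.2]
      exact Multiset.replicate_mono _ (by omega)
    · rw [Multiset.sum_replicate]
      apply AddSubgroup.nsmul_eq_zero_of_card hker
      rw [AddMonoidHom.mem_ker, map_nsmul]
      simp
  obtain ⟨x₀, hx₀⟩ := Multiset.card_pos_iff_exists_mem.1
    (show 0 < Multiset.card C by rw [(h.2.1 C hC).1]; omega)
  refine ⟨x₀, fun x hx hxa => ?_⟩
  have hr0 : x₀ = r := h.eq_of_map_eq hm hI hker hz hC hx₀ hrR (by rw [hr, hCa _ hx₀])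
  rw [h.1] at hx
  rcases Multiset.mem_add.1 hx with hx | hx
  · obtain ⟨D, hD, hxD⟩ := Multiset.mem_join.1 hx
    rw [hr0]
    exact h.eq_of_map_eq hm hI hker hz hD hxD hrR (by rw [hr, hxa])
  · exact (h.eq_of_map_eq hm hI hker hz hC hx₀ hx (by rw [hxa, hCa _ hx₀])).symm

theorem InverseEGZ.exists_pair_of_ker [IsAddCyclic φ.ker] (hp : p.Prime) (hm : 2 ≤ m)
    (hI : InverseEGZ m) (hker : Nat.card φ.ker = m)
    (hS : Multiset.card S + 2 = 2 * (p * m)) (hz : ¬ HasZeroSumSubseq (p * m) S) :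
    ∃ a b, S = Multiset.replicate (p * m - 1) a + Multiset.replicate (p * m - 1) b := by
  have hp2 := hp.two_le
  obtain ⟨B, R, h⟩ := IsBlockDecomp.exists_decomp hp.pos φ (2 * m - 2) S (by
    have : 2 * m - 2 + 1 = 2 * m - 1 := by omega
    rw [this, Nat.sub_mul]
    have : 2 * m * p = 2 * (p * m) := by ring
    omega)
  obtain ⟨a, b, hab, hR⟩ := h.exists_pair hp hm hker hS hz
  obtain ⟨x₀, hx₀⟩ := h.exists_forall_eq hp hm hI hker hS hz hab hR
  obtain ⟨y₀, hy₀⟩ := h.exists_forall_eq hp hm hI hker hS hz hab.symm (by rw [hR, add_comm])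
  have hS2 : ∀ x ∈ S, x = x₀ ∨ x = y₀ := by
    intro x hx
    have : φ x = a ∨ φ x = b := by
      have hx' := hx
      rw [h.1] at hx'
      rcases Multiset.mem_add.1 hx' with hx' | hx'
      · obtain ⟨D, hD, hxD⟩ := Multiset.mem_join.1 hx'
        exact h.eq_or_eq_of_mem hp hm hker hS hz hab hR hD (Multiset.mem_map_of_mem φ hxD)
      · have := Multiset.mem_map_of_mem φ hx'
        rw [hR] at this
        exact (Multiset.mem_add.1 this).imp Multiset.eq_of_mem_replicate
          Multiset.eq_of_mem_replicate
    exact this.imp (hx₀ x hx) (hy₀ x hx)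
  have hzero : ∀ (x : G) (i : ℕ), Multiset.replicate i x ≤ S → i ≤ p * m - 1 := by
    intro x i hi
    by_contra! hlt
    refine hz ⟨Multiset.replicate (p * m) x,
      (Multiset.replicate_mono _ (by omega)).trans hi, by simp, ?_⟩
    rw [Multiset.sum_replicate, mul_comm, mul_nsmul']
    apply AddSubgroup.nsmul_eq_zero_of_card hker
    rw [AddMonoidHom.mem_ker, map_nsmul]
    simp
  obtain ⟨i, hi, h1⟩ := Multiset.eq_replicate_add_replicate hS2
  have hi1 := hzero x₀ i ((Multiset.le_add_right _ _).trans h1.ge)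
  have hi2 := hzero y₀ (Multiset.card S - i) ((Multiset.le_add_left _ _).trans h1.ge)
  refine ⟨x₀, y₀, ?_⟩
  have e1 : i = p * m - 1 := by omega
  have e2 : Multiset.card S - i = p * m - 1 := by omega
  rwa [e2, e1] at h1

end Composite

/-- The inverse problem associated to the Erdős–Ginzburg–Ziv theorem for cyclic groups. -/
theorem inverseEGZ (n : ℕ) (hn : 2 ≤ n) : InverseEGZ n := by
  induction n using Nat.strong_induction_on with
  | _ n ih =>
    by_cases hp : n.Prime
    · exact inverseEGZ_prime hp
    obtain ⟨m, hm⟩ := Nat.minFac_dvd n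
    set p := n.minFac
    have hpp : p.Prime := Nat.minFac_prime (by omega)
    have hm2 : 2 ≤ m := by
      by_contra! h
      have : m = 0 ∨ m = 1 := by omega
      rcases this with rfl | rfl
      · omega
      · rw [mul_one] at hm
        exact hp (hm ▸ hpp)
    have hmn : m < n := by
      rw [hm]; nlinarith [hpp.two_le]
    have : NeZero n := ⟨by omega⟩
    have : NeZero p := ⟨hpp.ne_zero⟩
    have hpn : p ∣ n := Nat.minFac_dvd n
    let φ : ZMod n →+ ZMod p := (ZMod.castHom hpn (ZMod p)).toAddMonoidHom
    have hφ : Function.Surjective φ := ZMod.castHom_surjective hpn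
    have hker : Nat.card φ.ker = m := by
      have h1 := φ.ker.card_mul_index
      rw [AddSubgroup.index_ker, AddMonoidHom.range_eq_top.2 hφ, AddSubgroup.card_top, Nat.card_zmod, Nat.card_zmod] at h1
      exact Nat.eq_of_mul_eq_mul_right hpp.pos (h1.trans (hm.trans (mul_comm p m)))
    intro P hP hz
    have := InverseEGZ.exists_pair_of_ker (φ := φ) (S := P) hpp hm2 (ih m hmn hm2) hker
      (by rw [← hm]; exact hP) (by rw [← hm]; exact hz)
    rwa [← hm] at this

/-! ### Affine planes in `C₂³`. -/

/-- The elementary abelian group of order `8`. -/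
abbrev BinaryCube : Type := ZMod 2 × ZMod 2 × ZMod 2

namespace BinaryCube

/-- The affine plane through `x, y, z` (with fourth point `x + y + z`) is non-degenerate and
avoids `v`. -/
def PlaneAvoids (v x y z : BinaryCube) : Prop :=
  x ≠ y ∧ x ≠ z ∧ y ≠ z ∧ x ≠ v ∧ y ≠ v ∧ z ≠ v ∧ x + y + z ≠ v

instance (v x y z : BinaryCube) : Decidable (PlaneAvoids v x y z) := by
  unfold PlaneAvoids; infer_instance

theorem add_self (x : BinaryCube) : x + x = 0 := by
  revert x; decide

/-- Of the four lines parallel to `{w, x}`, discard the one through `v`. The other three span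
pairwise the three planes; the two planes through `{w, x}` minus the third count `w` and `x` twice
and nothing else. -/
theorem exists_three_planes : ∀ v w x : BinaryCube, w ≠ v → x ≠ v → w ≠ x →
    ∃ y, PlaneAvoids v w x y ∧ PlaneAvoids v w x (y + x + v) ∧
      PlaneAvoids v y (w + x + y) (y + x + v) ∧
      y + (w + x + y) + (y + x + v) = w + x + (y + x + v) := by
  decide +kernel

theorem exists_plane_avoiding : ∀ v w : BinaryCube, ∃ x y z, PlaneAvoids v x y z ∧
    PlaneAvoids w x y z := by
  decide +kernel

theorem exists_plane_through : ∀ v w : BinaryCube, w ≠ v → ∃ x y, PlaneAvoids v w x y := by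
  decide +kernel

theorem exists_ne (w : BinaryCube) : ∃ v, w ≠ v := by
  revert w; decide

theorem fourth_ne : ∀ v x y z : BinaryCube, PlaneAvoids v x y z →
    x ≠ x + y + z ∧ y ≠ x + y + z ∧ z ≠ x + y + z := by
  decide +kernel

variable {G : Type*} [AddCommGroup G] {g : BinaryCube → G} {v : BinaryCube} {c : G}

theorem two_nsmul_add_two_nsmul
    (h : ∀ x y z, PlaneAvoids v x y z → g x + g y + g z + g (x + y + z) = c)
    {w x : BinaryCube} (hw : w ≠ v) (hx : x ≠ v) (hwx : w ≠ x) : 2 • g w + 2 • g x = c := by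
  obtain ⟨y, h1, h2, h3, h4⟩ := exists_three_planes v w x hw hx hwx
  have e1 := h _ _ _ h1
  have e2 := h _ _ _ h2
  have e3 := h _ _ _ h3
  rw [h4] at e3
  have : 2 • g w + 2 • g x = c + c - c := by
    nth_rewrite 1 [← e1]
    nth_rewrite 1 [← e2]
    rw [← e3]
    abel
  simpa using this

/-- If all planes avoiding `v` have the same sum `c`, then `c = 4 g(w)` for all `w ≠ v`. -/
theorem four_nsmul_eq
    (h : ∀ x y z, PlaneAvoids v x y z → g x + g y + g z + g (x + y + z) = c)
    {w : BinaryCube} (hw : w ≠ v) : 2 • g w + 2 • g w = c := by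
  -- `(2w + 2x) + (2w + 2y) - (2x + 2y) = 4w`, with values of `g` understood.
  obtain ⟨x, y, h1, h2, h3, -, h4, h5, -⟩ := exists_plane_through v w hw
  have e1 := two_nsmul_add_two_nsmul h hw h4 h1
  have e2 := two_nsmul_add_two_nsmul h hw h5 h2
  have e3 := two_nsmul_add_two_nsmul h h4 h5 h3
  have : 2 • g w + 2 • g w = c + c - c := by
    nth_rewrite 1 [← e1]
    nth_rewrite 1 [← e2]
    rw [← e3]
    abel
  simpa using this

end BinaryCube

open BinaryCube

/-! ### Transversals of the classes whose planes all have the same sum. -/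

section Transversal

variable {G : Type*} [AddCommGroup G] {φ : G →+ BinaryCube} {T : Multiset G} {v : BinaryCube} {c : G}

theorem sum_eq_of_plane
    (hc : ∀ F ≤ T, Multiset.card F = 4 → F.sum ∈ φ.ker → F.sum = c)
    {x y z t : G} (hx : x ∈ T) (hy : y ∈ T) (hz : z ∈ T) (ht : t ∈ T)
    (hp : PlaneAvoids v (φ x) (φ y) (φ z)) (hφ : φ t = φ x + φ y + φ z) : x + y + z + t = c := by
  have h4 := fourth_ne _ _ _ _ hp
  rw [← hφ] at h4
  have hnd : ({x, y, z, t} : Multiset G).Nodup := by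
    have : (({x, y, z, t} : Multiset G).map φ).Nodup := by
      simp [hp.1, hp.2.1, hp.2.2.1, h4]
    exact this.of_map
  have := hc {x, y, z, t} ((Multiset.le_iff_subset hnd).2 fun s hs => by
    simp only [Multiset.insert_eq_cons, Multiset.mem_cons, Multiset.mem_singleton] at hs
    rcases hs with rfl | rfl | rfl | rfl <;> assumption) (by simp) (by
      rw [AddMonoidHom.mem_ker]
      simp only [Multiset.insert_eq_cons, Multiset.sum_cons, Multiset.sum_singleton, map_add, hφ]
      rw [← BinaryCube.add_self (φ x + φ y + φ z)]; abel)
  simpa [add_assoc] using this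

theorem four_nsmul_eq_of_planes (hT : (T.map φ).Nodup) (hv : ∀ u, u ≠ v → u ∈ T.map φ)
    (hc : ∀ F ≤ T, Multiset.card F = 4 → F.sum ∈ φ.ker → F.sum = c)
    {z : G} (hz : z ∈ T) (hzv : φ z ≠ v) : 2 • z + 2 • z = c := by
  have hex : ∀ u, ∃ t, u ≠ v → t ∈ T ∧ φ t = u := fun u => by
    by_cases h : u = v
    · exact ⟨0, fun h' => absurd h h'⟩
    · obtain ⟨t, ht⟩ := Multiset.mem_map.1 (hv u h)
      exact ⟨t, fun _ => ht⟩
  choose g hg using hex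
  have hgz : g (φ z) = z :=
    Multiset.inj_on_of_nodup_map hT _ (hg _ hzv).1 _ hz (hg _ hzv).2
  rw [← hgz]
  refine four_nsmul_eq (v := v) (fun x y z hp => ?_) hzv
  obtain ⟨h1, h2, h3, h4, h5, h6, h7⟩ := id hp
  refine sum_eq_of_plane (v := v) hc (hg x h4).1 (hg y h5).1 (hg z h6).1 (hg _ h7).1 ?_ ?_
  · rwa [(hg x h4).2, (hg y h5).2, (hg z h6).2]
  · rw [(hg x h4).2, (hg y h5).2, (hg z h6).2, (hg _ h7).2]

theorem exists_plane_le {w : BinaryCube}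
    (hv : ∀ u, u ≠ v → u ∈ T.map φ) : ∃ x ∈ T, ∃ y ∈ T, ∃ z ∈ T, ∃ t ∈ T,
      PlaneAvoids v (φ x) (φ y) (φ z) ∧ φ t = φ x + φ y + φ z ∧
      φ x ≠ w ∧ φ y ≠ w ∧ φ z ≠ w ∧ φ t ≠ w := by
  obtain ⟨x', y', z', hp, -, -, -, hx, hy, hz, ht⟩ := exists_plane_avoiding v w
  obtain ⟨h1, h2, h3, h4, h5, h6, h7⟩ := id hp
  obtain ⟨x, hxT, rfl⟩ := Multiset.mem_map.1 (hv _ h4)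
  obtain ⟨y, hyT, rfl⟩ := Multiset.mem_map.1 (hv _ h5)
  obtain ⟨z, hzT, rfl⟩ := Multiset.mem_map.1 (hv _ h6)
  obtain ⟨t, htT, ht'⟩ := Multiset.mem_map.1 (hv _ h7)
  exact ⟨x, hxT, y, hyT, z, hzT, t, htT, hp, ht', hx, hy, hz, by rwa [ht']⟩

/-- If all planes in two transversals differing in one term have constant sum, then the
transversals agree. -/
theorem eq_of_planes {x z : G} {c' : G} (hxz : φ x = φ z) (hzv : φ z ≠ v)
    (hv : ∀ u, u ≠ v → u ∈ (z ::ₘ T).map φ)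
    (hc : ∀ F ≤ z ::ₘ T, Multiset.card F = 4 → F.sum ∈ φ.ker → F.sum = c)
    (hc' : ∀ F ≤ x ::ₘ T, Multiset.card F = 4 → F.sum ∈ φ.ker → F.sum = c') : x = z := by
  have hmem : ∀ t ∈ z ::ₘ T, φ t ≠ φ z → t ∈ T := fun t ht hne =>
    (Multiset.mem_cons.1 ht).resolve_left (fun h => hne (by rw [h]))
  -- A plane avoiding the class of `z` lies in both transversals, so the two constants agree.
  -- Comparing a plane through `z` with its copy through `x` then gives `x = z`.
  have hcc : c = c' := by
    obtain ⟨p, hp, q, hq, r, hr, t, ht, hpl, hφ, h1, h2, h3, h4⟩ :=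
      exists_plane_le (w := φ z) hv
    rw [← sum_eq_of_plane hc hp hq hr ht hpl hφ]
    exact sum_eq_of_plane hc' (Multiset.mem_cons_of_mem (hmem p hp h1))
      (Multiset.mem_cons_of_mem (hmem q hq h2)) (Multiset.mem_cons_of_mem (hmem r hr h3))
      (Multiset.mem_cons_of_mem (hmem t ht h4)) hpl hφ
  obtain ⟨p', q', hpl⟩ := exists_plane_through v (φ z) hzv
  have h4 := fourth_ne _ _ _ _ hpl
  obtain ⟨h1, h2, -, -, h5, h6, h7⟩ := id hpl
  obtain ⟨p, hp, rfl⟩ := Multiset.mem_map.1 (hv _ h5)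
  obtain ⟨q, hq, rfl⟩ := Multiset.mem_map.1 (hv _ h6)
  obtain ⟨t, ht, ht'⟩ := Multiset.mem_map.1 (hv _ h7)
  have e1 := sum_eq_of_plane hc (Multiset.mem_cons_self _ _) hp hq ht hpl ht'
  have e2 := sum_eq_of_plane hc' (Multiset.mem_cons_self _ _)
    (Multiset.mem_cons_of_mem (hmem p hp h1.symm)) (Multiset.mem_cons_of_mem (hmem q hq h2.symm))
    (Multiset.mem_cons_of_mem (hmem t ht (by rw [ht']; exact h4.1.symm))) (by rwa [hxz])
    (by rwa [hxz])
  rw [hcc, ← e2] at e1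
  exact (add_right_cancel (add_right_cancel (add_right_cancel e1))).symm

end Transversal

/-! ### Pairs of terms in one class and their sums in the kernel. -/

/-- A multiset of pairs of terms in the same class modulo `φ`. -/
def IsPairs {G K : Type*} [AddCommGroup G] [AddCommGroup K] (φ : G →+ K)
    (B : Multiset (Multiset G)) : Prop :=
  ∀ b ∈ B, ∃ x y, b = {x, y} ∧ φ x = φ y

theorem exists_pairing {G K : Type*} [AddCommGroup G] [AddCommGroup K] (φ : G →+ K)
    (S : Multiset G) : ∃ B T, S = B.join + T ∧ IsPairs φ B ∧ (T.map φ).Nodup := by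
  induction S using Multiset.induction_on with
  | empty => exact ⟨0, 0, by simp, by simp [IsPairs], by simp⟩
  | cons s S ih =>
    obtain ⟨B, T, rfl, hB, hT⟩ := ih
    by_cases h : φ s ∈ T.map φ
    · obtain ⟨t, ht, hts⟩ := Multiset.mem_map.1 h
      obtain ⟨T, rfl⟩ := Multiset.exists_cons_of_mem ht
      refine ⟨{s, t} ::ₘ B, T, ?_, ?_, ?_⟩
      · rw [Multiset.join_cons, Multiset.insert_eq_cons]
        simp only [← Multiset.singleton_add]
        abel
      · intro b hb
        rcases Multiset.mem_cons.1 hb with rfl | hb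
        · exact ⟨s, t, rfl, hts.symm⟩
        · exact hB b hb
      · rw [Multiset.map_cons] at hT
        exact (Multiset.nodup_cons.1 hT).2
    · refine ⟨B, s ::ₘ T, by rw [Multiset.add_cons], hB, ?_⟩
      rw [Multiset.map_cons]
      exact Multiset.nodup_cons.2 ⟨h, hT⟩

theorem Multiset.replicate_le_of_cons_eq {α : Type*} {k : ℕ} {a b t : α} {R : Multiset α}
    (h : t ::ₘ R = Multiset.replicate (k + 1) a + Multiset.replicate (k + 1) b) :
    Multiset.replicate k a + Multiset.replicate k b ≤ R := by
  have ht : t ∈ Multiset.replicate (k + 1) a + Multiset.replicate (k + 1) b := by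
    rw [← h]; exact Multiset.mem_cons_self _ _
  rcases Multiset.mem_add.1 ht with h1 | h1 <;> obtain rfl := Multiset.eq_of_mem_replicate h1
  · nth_rewrite 1 [Multiset.replicate_succ] at h
    rw [Multiset.cons_add, Multiset.cons_inj_right] at h
    rw [h]
    exact add_le_add le_rfl (Multiset.replicate_mono _ (Nat.le_succ _))
  · nth_rewrite 2 [Multiset.replicate_succ] at h
    rw [Multiset.add_cons, Multiset.cons_inj_right] at h
    rw [h]
    exact add_le_add (Multiset.replicate_mono _ (Nat.le_succ _)) le_rfl

namespace IsPairs

variable {G : Type*} [AddCommGroup G] {φ : G →+ BinaryCube} {n : ℕ} {S T : Multiset G}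
  {B : Multiset (Multiset G)}

theorem card_eq_two (hB : IsPairs φ B) : ∀ b ∈ B, Multiset.card b = 2 := by
  intro b hb
  obtain ⟨x, y, rfl, -⟩ := hB b hb
  rfl

theorem mem_ker (hB : IsPairs φ B) : ∀ r ∈ B.map Multiset.sum, r ∈ φ.ker := by
  intro r hr
  obtain ⟨b, hb, rfl⟩ := Multiset.mem_map.1 hr
  obtain ⟨x, y, rfl, hxy⟩ := hB b hb
  rw [AddMonoidHom.mem_ker, Multiset.insert_eq_cons, Multiset.sum_cons, Multiset.sum_singleton,
    map_add, hxy, BinaryCube.add_self]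

theorem cons (hB : IsPairs φ B) {x y : G} (h : φ x = φ y) : IsPairs φ ({x, y} ::ₘ B) := by
  intro b hb
  rcases Multiset.mem_cons.1 hb with rfl | hb
  · exact ⟨x, y, rfl, h⟩
  · exact hB b hb

theorem of_cons {b : Multiset G} (hB : IsPairs φ (b ::ₘ B)) : IsPairs φ B :=
  fun c hc => hB c (Multiset.mem_cons_of_mem hc)

theorem not_hasZeroSumSubseq (hB : IsPairs φ B) (hle : B.join ≤ S)
    (hz : ¬ HasZeroSumSubseq (2 * n) S) : ¬ HasZeroSumSubseq n (B.map Multiset.sum) :=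
  fun h => hz (h.of_blocks hB.card_eq_two hle (mul_comm _ _))

/-- A block of four terms cannot be completed to a zero-sum sequence by pairs. -/
theorem sum_add_ne (hB : IsPairs φ B) (hn : 2 ≤ n) (hle : B.join + T ≤ S)
    (hz : ¬ HasZeroSumSubseq (2 * n) S) {F : Multiset G} (hF : F ≤ T)
    (hF4 : Multiset.card F = 4) :
    ∀ U ≤ B.map Multiset.sum, Multiset.card U = n - 2 → F.sum + U.sum ≠ 0 := by
  intro U hU hUc h0
  obtain ⟨C, hC, rfl⟩ := Multiset.exists_le_map_eq hU
  refine hz ⟨C.join + F, (add_le_add (Multiset.join_le_join hC) hF).trans hle, ?_, ?_⟩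
  · rw [Multiset.card_add, Multiset.card_join_of_forall fun b hb =>
      hB.card_eq_two b (Multiset.mem_of_le hC hb), hF4]
    rw [Multiset.card_map] at hUc
    omega
  · rw [Multiset.sum_add, Multiset.sum_join', add_comm, h0]

/-- Deleting `t` leaves at least `a^(n-2) b^(n-2)` among the pair sums, which is what
`IsExtremalPair.eq_add` needs. The term `t` need not be a pair sum itself. -/
theorem sum_eq_add (hB : IsPairs φ B) (hn : 2 ≤ n) (hker : Nat.card φ.ker = n)
    (hle : B.join + T ≤ S) (hz : ¬ HasZeroSumSubseq (2 * n) S) {a b t : G}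
    (hab : IsExtremalPair φ.ker n a b)
    (hR : t ::ₘ B.map Multiset.sum = Multiset.replicate (n - 1) a + Multiset.replicate (n - 1) b) :
    ∀ F ≤ T, Multiset.card F = 4 → F.sum ∈ φ.ker → F.sum = a + b := by
  intro F hF hF4 hFk
  obtain ⟨k, rfl⟩ := Nat.exists_eq_add_of_le' hn
  exact hab.eq_add hn hker hFk (Multiset.replicate_le_of_cons_eq hR)
    (hB.sum_add_ne hn hle hz hF hF4)

theorem exists_extremalPair [IsAddCyclic φ.ker] (hB : IsPairs φ B) (hn : 2 ≤ n)
    (hker : Nat.card φ.ker = n) (hc : Multiset.card B + 3 = 2 * n)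
    (hle : B.join + T ≤ S) (hz : ¬ HasZeroSumSubseq (2 * n) S)
    {F : Multiset G} (hF : F ≤ T) (hF4 : Multiset.card F = 4) (hFk : F.sum ∈ φ.ker) :
    ∃ a b t, IsExtremalPair φ.ker n a b ∧
      t ::ₘ B.map Multiset.sum = Multiset.replicate (n - 1) a + Multiset.replicate (n - 1) b := by
  set R := B.map Multiset.sum with hRdef
  have hRk : ∀ r ∈ R, r ∈ φ.ker := hB.mem_ker
  have hzR : ¬ HasZeroSumSubseq n R :=
    hB.not_hasZeroSumSubseq ((Multiset.le_add_right _ _).trans hle) hz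
  -- Only `2n - 3` pair sums exist, so a fictitious term is added. If `t` and `n - 1` pair sums had
  -- sum zero, the remaining `n - 2` pair sums together with `F` would have sum zero, giving a
  -- zero-sum subsequence of length `2n`.
  set t := -F.sum - R.sum with ht
  have htk : t ∈ φ.ker :=
    φ.ker.sub_mem (φ.ker.neg_mem hFk) (AddSubgroup.multiset_sum_mem _ _ hRk)
  have hRc : Multiset.card R + 3 = 2 * n := by rw [hRdef, Multiset.card_map, hc]
  obtain ⟨a, b, hab, h⟩ := (inverseEGZ n hn).exists_pair (H := φ.ker) hn hker (P := t ::ₘ R)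
    (fun x hx => by
      rcases Multiset.mem_cons.1 hx with rfl | hx
      exacts [htk, hRk x hx]) (by rw [Multiset.card_cons]; omega) (by
      rintro ⟨U, hU, hUc, hU0⟩
      by_cases htU : t ∈ U
      · obtain ⟨U, rfl⟩ := Multiset.exists_cons_of_mem htU
        obtain ⟨W, hW⟩ := Multiset.le_iff_exists_add.1 ((Multiset.cons_le_cons_iff _).1 hU)
        rw [Multiset.card_cons] at hUc
        refine hB.sum_add_ne hn hle hz hF hF4 W ((Multiset.le_add_left _ _).trans hW.ge) ?_ ?_
        · rw [hW, Multiset.card_add] at hRc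
          omega
        · rw [Multiset.sum_cons, ht, hW, Multiset.sum_add] at hU0
          rw [← neg_eq_zero, ← hU0]
          abel
      · exact hzR ⟨U, (Multiset.le_cons_of_notMem htU).1 hU, hUc, hU0⟩)
  exact ⟨a, b, t, hab, h⟩

end IsPairs

/-! ### Structure of sequences of length `4n + 2` and the upper bound for `s(G)`. -/

section Structure

variable {G : Type*} [AddCommGroup G] {φ : G →+ BinaryCube} {n : ℕ} {S T : Multiset G}
  {B : Multiset (Multiset G)}

theorem IsExtremalPair.false_of_two_nsmul {H : AddSubgroup G} {a b z : G} (hn : 2 ≤ n)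
    (hH : Nat.card H = n) (h : IsExtremalPair H n a b) (h1 : z + z = a ∨ z + z = b)
    (h2 : 2 • z + 2 • z = a + b) : False := by
  rw [two_nsmul] at h2
  rcases h1 with h1 | h1 <;> rw [h1] at h2
  · exact h.ne hn hH (add_left_cancel h2)
  · exact h.ne hn hH (add_right_cancel h2).symm

/-- The remainder does not cover all classes. -/
theorem card_remainder_ne_eight [IsAddCyclic φ.ker] (hn : 2 ≤ n) (hker : Nat.card φ.ker = n)
    (hS : Multiset.card S = 4 * n + 2) (hz : ¬ HasZeroSumSubseq (2 * n) S)
    (hBT : S = B.join + T) (hB : IsPairs φ B) (hT : (T.map φ).Nodup) : Multiset.card T ≠ 8 := by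
  intro hT8
  have hall : ∀ u, u ∈ T.map φ := by
    have : (⟨T.map φ, hT⟩ : Finset BinaryCube) = Finset.univ := by
      rw [← Finset.card_eq_iff_eq_univ, Finset.card_mk, Multiset.card_map, hT8]
      rfl
    intro u
    have h := Finset.mem_univ u
    rw [← this] at h
    exact h
  have hcB : Multiset.card B + 3 = 2 * n := by
    rw [hBT, Multiset.card_add, Multiset.card_join_of_forall hB.card_eq_two, hT8] at hS
    omega
  have hcase : ∀ {B' : Multiset (Multiset G)} {T' : Multiset G}, IsPairs φ B' →
      Multiset.card B' + 3 = 2 * n → B'.join + T' ≤ S → (∀ u, u ∈ T'.map φ) →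
      ∃ a b t, IsExtremalPair φ.ker n a b ∧
      t ::ₘ B'.map Multiset.sum = Multiset.replicate (n - 1) a + Multiset.replicate (n - 1) b ∧
      ∀ F ≤ T', Multiset.card F = 4 → F.sum ∈ φ.ker → F.sum = a + b := by
    intro B' T' hB' hc' hle hT'
    obtain ⟨p, hp, q, hq, r, hr, s, hs, hpl, hφ, -⟩ :=
      exists_plane_le (T := T') (v := 0) (w := 0) (fun u _ => hT' u)
    have h4 := fourth_ne _ _ _ _ hpl
    rw [← hφ] at h4
    have hnd : (({p, q, r, s} : Multiset G).map φ).Nodup := by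
      simp [hpl.1, hpl.2.1, hpl.2.2.1, h4]
    obtain ⟨a, b, t, hab, h⟩ := hB'.exists_extremalPair hn hker hc' hle hz (F := {p, q, r, s})
      ((Multiset.le_iff_subset hnd.of_map).2 fun s hs => by
        simp only [Multiset.insert_eq_cons, Multiset.mem_cons, Multiset.mem_singleton] at hs
        rcases hs with rfl | rfl | rfl | rfl <;> assumption) (by simp) (by
        rw [AddMonoidHom.mem_ker]
        simp only [Multiset.insert_eq_cons, Multiset.sum_cons, Multiset.sum_singleton, map_add, hφ]
        rw [← BinaryCube.add_self (φ p + φ q + φ r)]; abel)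
    exact ⟨a, b, t, hab, h, hB'.sum_eq_add hn hker hle hz hab h⟩
  obtain ⟨c, hc⟩ := Multiset.card_pos_iff_exists_mem.1 (show 0 < Multiset.card B by omega)
  obtain ⟨B, rfl⟩ := Multiset.exists_cons_of_mem hc
  obtain ⟨x, y, rfl, hxy⟩ := hB _ hc
  obtain ⟨z, hzT, hzx⟩ := Multiset.mem_map.1 (hall (φ x))
  obtain ⟨T, rfl⟩ := Multiset.exists_cons_of_mem hzT
  obtain ⟨v, hv⟩ := BinaryCube.exists_ne (φ z)
  obtain ⟨a, b, t, hab, h1, h2⟩ := hcase hB hcB hBT.ge hall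
  -- Exchanging `z` with a term of the pair in its class gives another transversal with constant
  -- plane sums, so both terms of the pair equal `z`.
  have hswap : ∀ p q : G, ({x, y} : Multiset G) = {p, q} → φ p = φ z → φ q = φ z → p = z := by
    intro p q hpq hp hq
    obtain ⟨a', b', t', -, -, h2'⟩ := hcase (B' := {z, q} ::ₘ B) (T' := p ::ₘ T)
      (hB.of_cons.cons hq.symm) (by simpa using hcB) (by
        rw [hBT, hpq, Multiset.join_cons, Multiset.join_cons]
        apply le_of_eq
        simp only [Multiset.insert_eq_cons, ← Multiset.singleton_add]
        abel) (by rwa [Multiset.map_cons, hp, ← Multiset.map_cons])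
    exact eq_of_planes hp hv (fun u _ => hall u) h2 h2'
  have e1 := hswap x y rfl hzx.symm (by rw [← hxy, hzx])
  have e2 := hswap y x (Multiset.pair_comm _ _) (by rw [← hxy, hzx]) hzx.symm
  -- Now `2z` is a pair sum, so it is `a` or `b`, although `4z = a + b`.
  have h4 := four_nsmul_eq_of_planes hT (v := v) (fun u _ => hall u) h2
    (Multiset.mem_cons_self z T) hv
  refine hab.false_of_two_nsmul hn hker ?_ h4
  have hmem : z + z ∈ Multiset.replicate (n - 1) a + Multiset.replicate (n - 1) b := by
    rw [← h1, e1, e2]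
    simp
  exact (Multiset.mem_add.1 hmem).imp Multiset.eq_of_mem_replicate Multiset.eq_of_mem_replicate

theorem card_pairs_of_card_remainder (hS : Multiset.card S = 4 * n + 2)
    (hBT : S = B.join + T) (hB : IsPairs φ B) (hT6 : Multiset.card T = 6) :
    Multiset.card B + 2 = 2 * n := by
  rw [hBT, Multiset.card_add, Multiset.card_join_of_forall hB.card_eq_two, hT6] at hS
  omega

/-- If the remainder has length `6`, then all pairs lie in the classes of the remainder. -/
theorem mem_map_of_mem_pair [IsAddCyclic φ.ker] (hn : 2 ≤ n) (hker : Nat.card φ.ker = n)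
    (hS : Multiset.card S = 4 * n + 2) (hz : ¬ HasZeroSumSubseq (2 * n) S)
    (hBT : S = B.join + T) (hB : IsPairs φ B) (hT : (T.map φ).Nodup) (hT6 : Multiset.card T = 6)
    {x y : G} (hxy : {x, y} ∈ B) (hφ : φ x = φ y) : φ x ∈ T.map φ := by
  by_contra hx
  have hcB := card_pairs_of_card_remainder hS hBT hB hT6
  obtain ⟨B, rfl⟩ := Multiset.exists_cons_of_mem hxy
  have hT' : ((x ::ₘ T).map φ).Nodup := by
    rw [Multiset.map_cons]
    exact Multiset.nodup_cons.2 ⟨hx, hT⟩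
  -- With `x` the remainder covers seven classes; `v` is the missing one.
  obtain ⟨v, hv⟩ : ∃ v, (⟨(x ::ₘ T).map φ, hT'⟩ : Finset BinaryCube)ᶜ = {v} := by
    rw [← Finset.card_eq_one, Finset.card_compl, Finset.card_mk, Multiset.card_map,
      Multiset.card_cons, hT6]
    rfl
  have hv' : ∀ u, u ≠ v ↔ u ∈ (x ::ₘ T).map φ := by
    intro u
    have : u ∈ (⟨(x ::ₘ T).map φ, hT'⟩ : Finset BinaryCube)ᶜ ↔ u ∈ ({v} : Finset BinaryCube) := by
      rw [hv]
    rw [Finset.mem_compl, Finset.mem_singleton, Finset.mem_mk] at this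
    rw [ne_eq, ← this, not_not]
  have hxv : φ x ≠ v := (hv' _).2 (Multiset.mem_map_of_mem _ (Multiset.mem_cons_self _ _))
  obtain ⟨a, b, hab, hR⟩ := (inverseEGZ n hn).exists_pair hn hker hB.mem_ker
    (by rw [Multiset.card_map, hcB])
    (hB.not_hasZeroSumSubseq (hBT ▸ Multiset.le_add_right _ _) hz)
  have hR' := hR
  rw [Multiset.map_cons] at hR'
  -- Opening the pair `{x, y}` removes one of the `2n - 2` pair sums, and `x + y` plays the role of
  -- the deleted term `t` in `sum_eq_add`.
  have hcase : ∀ p q : G, ({x, y} : Multiset G) = {p, q} →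
      ∀ F ≤ p ::ₘ T, Multiset.card F = 4 → F.sum ∈ φ.ker → F.sum = a + b := by
    intro p q hpq
    refine hB.of_cons.sum_eq_add hn hker (le_trans ?_ hBT.ge) hz hab hR'
    rw [hpq, Multiset.join_cons]
    calc B.join + (p ::ₘ T) ≤ B.join + (p ::ₘ T) + {q} := Multiset.le_add_right _ _
      _ = _ := by
        simp only [Multiset.insert_eq_cons, ← Multiset.singleton_add]
        abel
  have e := eq_of_planes hφ.symm hxv (fun u hu => (hv' u).1 hu) (hcase x y rfl)
    (hcase y x (Multiset.pair_comm _ _))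
  have h4 := four_nsmul_eq_of_planes hT' (fun u hu => (hv' u).1 hu) (hcase x y rfl)
    (Multiset.mem_cons_self _ _) hxv
  refine hab.false_of_two_nsmul hn hker ?_ h4
  have hmem : x + x ∈ Multiset.replicate (n - 1) a + Multiset.replicate (n - 1) b := by
    rw [← hR', e]
    simp
  exact (Multiset.mem_add.1 hmem).imp Multiset.eq_of_mem_replicate Multiset.eq_of_mem_replicate

/-- If the remainder has length `6`, then every pair consists of twice the same term of the
remainder. -/
theorem eq_of_mem_pair [IsAddCyclic φ.ker] (hn : 2 ≤ n) (hker : Nat.card φ.ker = n)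
    (hS : Multiset.card S = 4 * n + 2) (hz : ¬ HasZeroSumSubseq (2 * n) S)
    (hBT : S = B.join + T) (hB : IsPairs φ B) (hT6 : Multiset.card T = 6)
    {x y z : G} (hxy : {x, y} ∈ B) (hzT : z ∈ T) (hy : φ y = φ z) : x = z := by
  have hcB := card_pairs_of_card_remainder hS hBT hB hT6
  obtain ⟨B, rfl⟩ := Multiset.exists_cons_of_mem hxy
  obtain ⟨T, rfl⟩ := Multiset.exists_cons_of_mem hzT
  -- Exchanging `x` and `z` alters one term of an extremal sequence of pair sums, hence `x + y = z +
  -- y`.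
  have hB' : IsPairs φ ({z, y} ::ₘ B) := hB.of_cons.cons hy.symm
  have hBT' : S = ({z, y} ::ₘ B).join + (x ::ₘ T) := by
    rw [hBT, Multiset.join_cons, Multiset.join_cons]
    simp only [Multiset.insert_eq_cons, ← Multiset.singleton_add]
    abel
  have h1 := hB.mem_ker
  have h2 := hB.not_hasZeroSumSubseq (hBT ▸ Multiset.le_add_right _ _) hz
  have h1' := hB'.mem_ker
  have h2' := hB'.not_hasZeroSumSubseq (hBT' ▸ Multiset.le_add_right _ _) hz
  rw [Multiset.map_cons] at h1 h2 h1' h2'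
  rw [Multiset.card_cons] at hcB
  have := (inverseEGZ n hn).eq_of_cons hn hker h1' (by rw [Multiset.card_map]; omega) h2'
    (h1 _ (Multiset.mem_cons_self _ _)) h2
  simpa using this

theorem Multiset.even_count_join {α : Type*} [DecidableEq α] {B : Multiset (Multiset α)}
    (hB : ∀ b ∈ B, ∃ z, b = {z, z}) (s : α) :
    Even (B.join.count s) := by
  induction B using Multiset.induction_on with
  | empty => simp
  | cons b B ih =>
    obtain ⟨z, rfl⟩ := hB b (Multiset.mem_cons_self _ _)
    rw [Multiset.join_cons, Multiset.count_add]
    refine Even.add ?_ (ih fun b hb => hB b (Multiset.mem_cons_of_mem hb))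
    by_cases h : s = z <;> simp [h]

/-- A sequence of length `4n + 2` without zero-sum subsequence of length `2n` has exactly six
distinct terms, each with odd multiplicity. -/
theorem odd_count_of_not_hasZeroSumSubseq [IsAddCyclic φ.ker] [DecidableEq G] (hn : 2 ≤ n)
    (hker : Nat.card φ.ker = n) (hS : Multiset.card S = 4 * n + 2)
    (hz : ¬ HasZeroSumSubseq (2 * n) S) :
    S.toFinset.card = 6 ∧ ∀ s ∈ S, Odd (S.count s) := by
  obtain ⟨B, T, hBT, hB, hT⟩ := exists_pairing φ S
  have hcard : Multiset.card B * 2 + Multiset.card T = 4 * n + 2 := by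
    rw [← hS, hBT, Multiset.card_add, Multiset.card_join_of_forall hB.card_eq_two]
  have hT8 : Multiset.card T ≤ 8 := by
    have := Finset.card_le_univ (⟨T.map φ, hT⟩ : Finset BinaryCube)
    rw [Finset.card_mk, Multiset.card_map] at this
    exact this
  -- With at most four terms left over there would be `2n - 1` pairs. By parity only the sizes 6 and
  -- 8 remain.
  have hT4 : 4 < Multiset.card T := by
    by_contra! h
    refine hB.not_hasZeroSumSubseq (hBT ▸ Multiset.le_add_right _ _) hz
      (AddSubgroup.hasZeroSumSubseq_of_card hker hB.mem_ker ?_)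
    rw [Multiset.card_map]
    omega
  have hT8' := card_remainder_ne_eight hn hker hS hz hBT hB hT
  have hT6 : Multiset.card T = 6 := by omega
  have hBz : ∀ b ∈ B, ∃ z ∈ T, b = {z, z} := by
    intro b hb
    obtain ⟨x, y, rfl, hxy⟩ := hB b hb
    obtain ⟨z, hzT, hzx⟩ := Multiset.mem_map.1
      (mem_map_of_mem_pair hn hker hS hz hBT hB hT hT6 hb hxy)
    refine ⟨z, hzT, ?_⟩
    have e1 := eq_of_mem_pair hn hker hS hz hBT hB hT6 hb hzT (by rw [← hxy, hzx])
    have e2 := eq_of_mem_pair hn hker hS hz hBT hB hT6 (Multiset.pair_comm x y ▸ hb) hzT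
      hzx.symm
    rw [e1, e2]
  have hST : ∀ s, s ∈ S ↔ s ∈ T := by
    intro s
    rw [hBT, Multiset.mem_add, or_iff_right_of_imp]
    intro hs
    obtain ⟨b, hb, hsb⟩ := Multiset.mem_join.1 hs
    obtain ⟨z, hz, rfl⟩ := hBz b hb
    simp only [Multiset.insert_eq_cons, Multiset.mem_cons, Multiset.mem_singleton, or_self] at hsb
    rwa [hsb]
  constructor
  · have : S.toFinset = ⟨T, hT.of_map⟩ := by
      ext s
      simp [hST]
    rw [this, Finset.card_mk, hT6]
  · intro s hs
    rw [hBT, Multiset.count_add, Multiset.count_eq_one_of_mem hT.of_map ((hST s).1 hs)]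
    exact (Multiset.even_count_join (fun b hb => (hBz b hb).imp fun z h => h.2) s).add_one

/-- Every sequence of length at least `4n + 3` has a zero-sum subsequence of length `2n`. -/
theorem hasZeroSumSubseq_of_le_card [IsAddCyclic φ.ker] (hn : 2 ≤ n)
    (hker : Nat.card φ.ker = n) (hS : 4 * n + 3 ≤ Multiset.card S) :
    HasZeroSumSubseq (2 * n) S := by
  classical
  obtain ⟨S', hS', hc⟩ : ∃ S' ≤ S, Multiset.card S' = 4 * n + 3 := by
    obtain ⟨S', h⟩ := Multiset.card_pos_iff_exists_mem.1
      (show 0 < Multiset.card (S.powersetCard (4 * n + 3)) by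
        rw [Multiset.card_powersetCard]; exact Nat.choose_pos hS)
    exact ⟨S', Multiset.mem_powersetCard.1 h⟩
  refine HasZeroSumSubseq.mono ?_ hS'
  by_contra hz
  have key : ∀ x ∈ S', (S'.erase x).toFinset.card = 6 ∧
      ∀ s ∈ S'.erase x, Odd ((S'.erase x).count s) := fun x hx =>
    odd_count_of_not_hasZeroSumSubseq (φ := φ) hn hker
      (by rw [Multiset.card_erase_of_mem hx, hc]; rfl)
      fun h => hz (h.mono (Multiset.erase_le _ _))
  obtain ⟨x₀, hx₀⟩ := Multiset.card_pos_iff_exists_mem.1 (show 0 < Multiset.card S' by omega)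
  -- Deleting some other term shows that the multiplicity of `y` is odd; deleting `y` itself would
  -- leave an even positive multiplicity unless it is 1. So all terms are distinct, and `4n + 2 = 6`
  -- contradicts `n ≥ 2`.
  have hone : ∀ y ∈ S', S'.count y = 1 := by
    intro y hy
    obtain ⟨x, hx, hxy⟩ : ∃ x ∈ (S'.erase y).toFinset, x ≠ y :=
      Finset.exists_mem_ne (by rw [(key y hy).1]; norm_num) y
    have hx' : x ∈ S'.erase y := Multiset.mem_toFinset.1 hx
    have hxS : x ∈ S' := Multiset.mem_of_mem_erase hx'
    have h1 := (key x hxS).2 y ((Multiset.mem_erase_of_ne hxy.symm).2 hy)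
    rw [Multiset.count_erase_of_ne hxy.symm] at h1
    by_contra hne
    have hpos := Multiset.count_pos.2 hy
    have h2 := (key y hy).2 y (Multiset.count_pos.1 (by
      rw [Multiset.count_erase_self]; omega))
    rw [Multiset.count_erase_self] at h2
    obtain ⟨i, hi⟩ := h1
    obtain ⟨j, hj⟩ := h2
    omega
  have hnd : S'.Nodup := Multiset.nodup_iff_count_eq_one.2 hone
  have h6 := (key x₀ hx₀).1
  rw [Multiset.toFinset_card_of_nodup (hnd.erase x₀), Multiset.card_erase_of_mem hx₀, hc] at h6
  have h6 : 4 * n + 2 = 6 := h6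
  omega

end Structure

/-! ### Height and the numerical bound. -/

theorem count_le_height {G : Type*} [inst : DecidableEq G] (S : Multiset G) (g : G) :
    S.count g ≤ height S := by
  classical
  obtain rfl : inst = fun a b => Classical.propDecidable (a = b) := Subsingleton.elim _ _
  by_cases hg : g ∈ S
  · exact Finset.le_sup (f := fun g => S.count g) (Multiset.mem_toFinset.2 hg)
  · rw [Multiset.count_eq_zero_of_notMem hg]
    exact Nat.zero_le _

theorem height_le {G : Type*} [inst : DecidableEq G] {S : Multiset G} {k : ℕ}
    (h : ∀ g ∈ S, S.count g ≤ k) : height S ≤ k := by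
  classical
  obtain rfl : inst = fun a b => Classical.propDecidable (a = b) := Subsingleton.elim _ _
  exact Finset.sup_le fun g hg => h g (Multiset.mem_toFinset.1 hg)

theorem exists_count_eq_height {G : Type*} [DecidableEq G] {S : Multiset G} (hS : S ≠ 0) :
    ∃ g ∈ S, S.count g = height S := by
  by_contra! h
  obtain ⟨g, hg⟩ := Multiset.exists_mem_of_ne_zero hS
  have hpos := (Multiset.count_pos.2 hg).trans_le (count_le_height S g)
  have := height_le (S := S) (k := height S - 1) fun g hg => by
    have := count_le_height S g
    have := h g hg
    omega
  omega

/-- A sequence of length `4n + 2` with exactly six distinct terms, all of odd multiplicity,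
satisfies the height bound. -/
theorem heightBound_le_height {G : Type*} [DecidableEq G] {S : Multiset G} {n : ℕ}
    (hS : Multiset.card S = 4 * n + 2) (h6 : S.toFinset.card = 6)
    (hodd : ∀ s ∈ S, Odd (S.count s)) : heightBound n ≤ (height S : ℚ) := by
  obtain ⟨g, hg, hgh⟩ := exists_count_eq_height (S := S) (by rintro rfl; simp at hS)
  obtain ⟨k, hk⟩ := hgh ▸ hodd g hg
  have hsum : Multiset.card S ≤ 6 * height S := by
    rw [← Multiset.toFinset_sum_count_eq S, ← h6]
    exact Finset.sum_le_card_nsmul _ _ _ fun x _ => count_le_height S x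
  rw [hk] at hsum ⊢
  -- The average multiplicity `(4n + 2)/6` rounds up to `2q + 1`, `2q + 1` and `2q + 2` in the three
  -- residue classes; oddness improves only the last one, to `2q + 3`.
  obtain ⟨q, hq⟩ : ∃ q, q = n / 3 := ⟨_, rfl⟩
  unfold heightBound
  split_ifs with h0 h1
  · have e : n = 3 * q := by omega
    have : 2 * q + 1 ≤ 2 * k + 1 := by omega
    have : (2 * q + 1 : ℚ) ≤ 2 * k + 1 := by exact_mod_cast this
    rw [e]; push_cast; linarith
  · have e : n = 3 * q + 1 := by omega
    have : 2 * q + 1 ≤ 2 * k + 1 := by omega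
    have : (2 * q + 1 : ℚ) ≤ 2 * k + 1 := by exact_mod_cast this
    rw [e]; push_cast; linarith
  · have e : n = 3 * q + 2 := by omega
    have : 2 * q + 3 ≤ 2 * k + 1 := by omega
    have : (2 * q + 3 : ℚ) ≤ 2 * k + 1 := by exact_mod_cast this
    rw [e]; push_cast; linarith

theorem heightParams_spec {n : ℕ} (hn : 2 ≤ n) :
    (heightParams n).1 + (heightParams n).2.1 + (heightParams n).2.2 + 1 = n ∧
    (heightParams n).2.1 ≤ (heightParams n).1 ∧ (heightParams n).2.2 ≤ (heightParams n).1 ∧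
    ((2 * (heightParams n).1 + 1 : ℕ) : ℚ) = heightBound n := by
  obtain ⟨q, hq⟩ : ∃ q, q = n / 3 := ⟨_, rfl⟩
  unfold heightParams heightBound
  split_ifs with h0 h1
  · have e : n = 3 * q := by omega
    have e1 : n / 3 = q := by omega
    refine ⟨by simp only; omega, by simp only; omega, by simp only; omega, ?_⟩
    simp only [e1]
    rw [e]; push_cast; ring
  · have e : n = 3 * q + 1 := by omega
    have e1 : (n - 1) / 3 = q := by omega
    refine ⟨by simp only; omega, by simp only; omega, by simp only; omega, ?_⟩
    simp only [e1]
    rw [e]; push_cast; ring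
  · have e : n = 3 * q + 2 := by omega
    have e1 : (n + 1) / 3 = q + 1 := by omega
    refine ⟨by simp only; omega, by simp only; omega, by simp only; omega, ?_⟩
    simp only [e1]
    rw [e]; push_cast; ring

/-! ### The explicit sequence. -/

theorem Multiset.exists_add_of_le_add {α : Type*} {s t u : Multiset α} (h : s ≤ t + u) :
    ∃ t' ≤ t, ∃ u' ≤ u, s = t' + u' := by
  classical
  exact ⟨s ∩ t, Multiset.inter_le_right, s - t, tsub_le_iff_left.2 h,
    by rw [add_comm, Multiset.sub_add_inter]⟩

theorem card_lowHeightSeq {G : Type*} [AddCommGroup G] (p : ℕ × ℕ × ℕ) (f₁ f₂ f₃ : G) :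
    Multiset.card (lowHeightSeq p f₁ f₂ f₃) = 4 * (p.1 + p.2.1 + p.2.2) + 6 := by
  simp only [lowHeightSeq, Multiset.card_add, Multiset.card_replicate]
  ring

theorem dvd_of_isGroupBasis {G : Type*} [AddCommGroup G] {f₁ f₂ f₃ : G}
    (hf : IsGroupBasis ![f₁, f₂, f₃]) {i j k : ℕ} (h : i • f₁ + j • f₂ + k • f₃ = 0) :
    addOrderOf f₁ ∣ i ∧ addOrderOf f₂ ∣ j ∧ addOrderOf f₃ ∣ k := by
  have := hf.1 ![i, j, k] (by simpa [Fin.sum_univ_three] using h)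
  refine ⟨?_, ?_, ?_⟩ <;> rw [addOrderOf_dvd_iff_nsmul_eq_zero]
  · simpa using this 0
  · simpa using this 1
  · simpa using this 2

theorem lowHeightSeq_not_hasZeroSumSubseq {G : Type*} [AddCommGroup G] {p : ℕ × ℕ × ℕ}
    {f₁ f₂ f₃ : G} {n : ℕ} (hp : p.1 + p.2.1 + p.2.2 + 1 = n) (hf : IsGroupBasis ![f₁, f₂, f₃])
    (h1 : addOrderOf f₁ = 2) (h2 : addOrderOf f₂ = 2) (h3 : addOrderOf f₃ = 2 * n) :
    ¬ HasZeroSumSubseq (2 * n) (lowHeightSeq p f₁ f₂ f₃) := by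
  rintro ⟨T, hT, hc, h0⟩
  obtain ⟨T, hT₅, U₆, hU₆, rfl⟩ := Multiset.exists_add_of_le_add hT
  obtain ⟨T, hT₄, U₅, hU₅, rfl⟩ := Multiset.exists_add_of_le_add hT₅
  obtain ⟨T, hT₃, U₄, hU₄, rfl⟩ := Multiset.exists_add_of_le_add hT₄
  obtain ⟨T, hT₂, U₃, hU₃, rfl⟩ := Multiset.exists_add_of_le_add hT₃
  obtain ⟨U₁, hU₁, U₂, hU₂, rfl⟩ := Multiset.exists_add_of_le_add hT₂
  obtain ⟨x₁, hx₁, rfl⟩ := Multiset.le_replicate_iff.1 hU₁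
  obtain ⟨x₂, hx₂, rfl⟩ := Multiset.le_replicate_iff.1 hU₂
  obtain ⟨x₃, hx₃, rfl⟩ := Multiset.le_replicate_iff.1 hU₃
  obtain ⟨y₁, hy₁, rfl⟩ := Multiset.le_replicate_iff.1 hU₄
  obtain ⟨y₂, hy₂, rfl⟩ := Multiset.le_replicate_iff.1 hU₅
  obtain ⟨y₃, hy₃, rfl⟩ := Multiset.le_replicate_iff.1 hU₆
  simp only [Multiset.card_add, Multiset.card_replicate] at hc
  simp only [Multiset.sum_add, Multiset.sum_replicate] at h0
  obtain ⟨d1, d2, k, hk⟩ := dvd_of_isGroupBasis hf (i := x₂ + y₁ + y₃) (j := x₃ + y₂ + y₃)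
    (k := y₁ + y₂ + y₃) (by rw [← h0]; simp only [smul_add, add_nsmul, smul_zero]; abel)
  rw [h1] at d1
  rw [h2] at d2
  rw [h3] at hk
  -- The coefficient `y₁ + y₂ + y₃` of `f₃` is 0 or `2n`, so the `2n` terms all lie in one half of
  -- the sequence. The conditions at `f₁` and `f₂` and the even total make all three multiplicities
  -- even, hence at most `2α`, `2β`, `2γ`, with total at most `2n - 2`.
  have hk2 : k < 2 := by
    by_contra! h
    have : 2 * n * 2 ≤ 2 * n * k := Nat.mul_le_mul_left _ h
    omega
  interval_cases k <;> omega

/-! ### The group `C₂ ⊕ C₂ ⊕ C₂ₙ`. -/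

section Main

variable {n : ℕ} {G : Type*} [AddCommGroup G]

/-- Reduce the last coordinate modulo 2. On the kernel the first two coordinates vanish, so it
embeds into `ZMod (2 * n)`. -/
theorem exists_hom_binaryCube (hn : 2 ≤ n) (e : G ≃+ ZMod 2 × ZMod 2 × ZMod (2 * n)) :
    ∃ φ : G →+ BinaryCube, IsAddCyclic φ.ker ∧ Nat.card φ.ker = n := by
  have : NeZero n := ⟨by omega⟩
  let c : ZMod (2 * n) →+ ZMod 2 := (ZMod.castHom (dvd_mul_right 2 n) (ZMod 2)).toAddMonoidHom
  have hc : Function.Surjective c := ZMod.castHom_surjective (dvd_mul_right 2 n)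
  let ψ : ZMod 2 × ZMod 2 × ZMod (2 * n) →+ BinaryCube :=
    (AddMonoidHom.id _).prodMap ((AddMonoidHom.id _).prodMap c)
  have hψ : Function.Surjective ψ :=
    Function.Surjective.prodMap Function.surjective_id
      (Function.Surjective.prodMap Function.surjective_id hc)
  let φ : G →+ BinaryCube := ψ.comp e.toAddMonoidHom
  have hφ : Function.Surjective φ := hψ.comp e.surjective
  refine ⟨φ, ?_, ?_⟩
  · let q : φ.ker →+ ZMod (2 * n) :=
      (((AddMonoidHom.snd _ _).comp (AddMonoidHom.snd _ _)).comp e.toAddMonoidHom).comp φ.ker.subtype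
    refine isAddCyclic_of_injective q fun x y hxy => ?_
    have hx : φ x = 0 := x.2
    have hy : φ y = 0 := y.2
    apply Subtype.ext
    apply e.injective
    refine Prod.ext ?_ (Prod.ext ?_ hxy)
    · exact (congrArg Prod.fst hx).trans (congrArg Prod.fst hy).symm
    · exact (congrArg (fun z => z.2.1) hx).trans (congrArg (fun z => z.2.1) hy).symm
  · have h1 := φ.ker.card_mul_index
    rw [AddSubgroup.index_ker, AddMonoidHom.range_eq_top.2 hφ, AddSubgroup.card_top,
      Nat.card_congr e.toEquiv] at h1
    simp only [Nat.card_prod, Nat.card_zmod] at h1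
    omega

theorem exponent_eq (e : G ≃+ ZMod 2 × ZMod 2 × ZMod (2 * n)) :
    AddMonoid.exponent G = 2 * n := by
  rw [AddMonoid.exponent_eq_of_addEquiv e, AddMonoid.exponent_prod, AddMonoid.exponent_prod,
    ZMod.exponent, ZMod.exponent]
  have h : Nat.lcm 2 (2 * n) = 2 * n := Nat.lcm_eq_right (Dvd.intro n rfl)
  exact (congrArg (Nat.lcm 2) h).trans h

theorem exists_isGroupBasis (e : G ≃+ ZMod 2 × ZMod 2 × ZMod (2 * n)) :
    ∃ f₁ f₂ f₃ : G, IsGroupBasis ![f₁, f₂, f₃] ∧ addOrderOf f₁ = 2 ∧ addOrderOf f₂ = 2 ∧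
      addOrderOf f₃ = 2 * n := by
  have hsum : ∀ a : Fin 3 → ℤ,
      ∑ i, a i • ![e.symm (1, 0, 0), e.symm (0, 1, 0), e.symm (0, 0, 1)] i =
        e.symm ((a 0 : ZMod 2), (a 1 : ZMod 2), (a 2 : ZMod (2 * n))) := by
    intro a
    simp [Fin.sum_univ_three, ← map_zsmul, ← map_add]
  refine ⟨e.symm (1, 0, 0), e.symm (0, 1, 0), e.symm (0, 0, 1), ⟨?_, ?_⟩, ?_, ?_, ?_⟩
  · intro a ha
    rw [hsum, EmbeddingLike.map_eq_zero_iff, Prod.mk_eq_zero, Prod.mk_eq_zero] at ha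
    obtain ⟨h0, h1, h2⟩ := ha
    intro i
    fin_cases i <;> simp [← map_zsmul, h0, h1, h2]
  · rw [eq_top_iff]
    intro x _
    obtain ⟨⟨a, b, c⟩, rfl⟩ := e.symm.surjective x
    obtain ⟨a, rfl⟩ := ZMod.intCast_surjective a
    obtain ⟨b, rfl⟩ := ZMod.intCast_surjective b
    obtain ⟨c, rfl⟩ := ZMod.intCast_surjective c
    have := hsum ![a, b, c]
    simp only [Matrix.cons_val_zero, Matrix.cons_val_one, Matrix.cons_val] at this
    rw [← this]
    exact AddSubgroup.sum_mem _ fun i _ => AddSubgroup.zsmul_mem _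
      (AddSubgroup.subset_closure (Set.mem_range_self i)) _
  all_goals
    rw [AddEquiv.addOrderOf_eq, Prod.addOrderOf_mk, Prod.addOrderOf_mk]
    simp

theorem egzConstant_eq (hn : 2 ≤ n) (e : G ≃+ ZMod 2 × ZMod 2 × ZMod (2 * n)) :
    egzConstant G = 4 * n + 3 := by
  obtain ⟨φ, hcyc, hker⟩ := exists_hom_binaryCube hn e
  obtain ⟨f₁, f₂, f₃, hf, h1, h2, h3⟩ := exists_isGroupBasis e
  have hp := (heightParams_spec hn).1
  have hmem : 4 * n + 3 ∈ {l : ℕ | ∀ S : Multiset G, l ≤ Multiset.card S →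
      HasZeroSumSubseq (AddMonoid.exponent G) S} := fun S hS => by
    rw [exponent_eq e]
    exact hasZeroSumSubseq_of_le_card hn hker hS
  refine le_antisymm (Nat.sInf_le hmem) ?_
  by_contra! hlt
  have := Nat.sInf_mem ⟨_, hmem⟩ (lowHeightSeq (heightParams n) f₁ f₂ f₃) (by
    rw [card_lowHeightSeq]
    change egzConstant G ≤ _
    omega)
  rw [exponent_eq e] at this
  exact lowHeightSeq_not_hasZeroSumSubseq hp hf h1 h2 h3 this

theorem isExtremalEGZ_iff (hn : 2 ≤ n) (e : G ≃+ ZMod 2 × ZMod 2 × ZMod (2 * n))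
    {S : Multiset G} :
    IsExtremalEGZ S ↔ Multiset.card S = 4 * n + 2 ∧ ¬ HasZeroSumSubseq (2 * n) S := by
  rw [IsExtremalEGZ, egzConstant_eq hn e, exponent_eq e]
  refine and_congr_left' ?_
  omega

/-- The hypothesis `h6` comes from the structure theorem and spares a direct check that the six
listed values are distinct. -/
theorem height_lowHeightSeq_le {p : ℕ × ℕ × ℕ} {f₁ f₂ f₃ : G} (h1 : p.2.1 ≤ p.1) (h2 : p.2.2 ≤ p.1)
    [DecidableEq G] (h6 : (lowHeightSeq p f₁ f₂ f₃).toFinset.card = 6) :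
    height (lowHeightSeq p f₁ f₂ f₃) ≤ 2 * p.1 + 1 := by
  set L : Multiset G := {0, f₁, f₂, f₃ + f₁, f₃ + f₂, f₃ + (f₁ + f₂)} with hL
  have hmem : ∀ g, g ∈ lowHeightSeq p f₁ f₂ f₃ ↔ g ∈ L := by
    intro g
    simp only [lowHeightSeq, hL, Multiset.mem_add, Multiset.mem_replicate, Multiset.insert_eq_cons,
      Multiset.mem_cons, Multiset.mem_singleton, or_assoc, ne_eq, Nat.succ_ne_zero,
      not_false_eq_true, true_and]
  have hnd : L.Nodup := by
    rw [← Multiset.toFinset_card_eq_card_iff_nodup]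
    have : (lowHeightSeq p f₁ f₂ f₃).toFinset = L.toFinset := by
      ext g
      simp only [Multiset.mem_toFinset, hmem]
    rw [← this, h6]
    rfl
  have hle : lowHeightSeq p f₁ f₂ f₃ ≤ (2 * p.1 + 1) • L := by
    rw [Multiset.le_iff_count]
    intro g
    rw [Multiset.count_nsmul]
    simp only [hL, lowHeightSeq, Multiset.insert_eq_cons, ← Multiset.singleton_add,
      Multiset.count_add, Multiset.count_replicate, Multiset.count_singleton, mul_add]
    simp only [@eq_comm _ g, mul_ite, mul_one, mul_zero, ← add_assoc]
    gcongr <;> split_ifs <;> omega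
  refine height_le fun g _ => ?_
  calc _ ≤ ((2 * p.1 + 1) • L).count g := Multiset.count_le_of_le _ hle
    _ = (2 * p.1 + 1) * L.count g := Multiset.count_nsmul _ _ _
    _ ≤ (2 * p.1 + 1) * 1 :=
      Nat.mul_le_mul_left _ (Multiset.nodup_iff_count_le_one.1 hnd g)
    _ = _ := mul_one _

end Main

theorem mainTheorem3 (n : ℕ) (hn : 2 ≤ n) (G : Type*) [AddCommGroup G]
    (hG : Nonempty (G ≃+ ZMod 2 × ZMod 2 × ZMod (2 * n))) :
    (∀ S : Multiset G, IsExtremalEGZ S → heightBound n ≤ (height S : ℚ)) ∧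
    (∃ S : Multiset G, IsExtremalEGZ S ∧ (height S : ℚ) = heightBound n) ∧
    (∀ f₁ f₂ f₃ : G, IsGroupBasis ![f₁, f₂, f₃] →
      addOrderOf f₁ = 2 → addOrderOf f₂ = 2 → addOrderOf f₃ = 2 * n →
      IsExtremalEGZ (lowHeightSeq (heightParams n) f₁ f₂ f₃) ∧
      (height (lowHeightSeq (heightParams n) f₁ f₂ f₃) : ℚ) = heightBound n) := by
  classical
  obtain ⟨e⟩ := hG
  obtain ⟨φ, hcyc, hker⟩ := exists_hom_binaryCube hn e
  have hlower : ∀ S : Multiset G, IsExtremalEGZ S →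
      S.toFinset.card = 6 ∧ heightBound n ≤ (height S : ℚ) := fun S hS => by
    obtain ⟨hc, hz⟩ := (isExtremalEGZ_iff hn e).1 hS
    obtain ⟨h6, hodd⟩ := odd_count_of_not_hasZeroSumSubseq hn hker hc hz
    exact ⟨h6, heightBound_le_height hc h6 hodd⟩
  have hexpl : ∀ f₁ f₂ f₃ : G, IsGroupBasis ![f₁, f₂, f₃] →
      addOrderOf f₁ = 2 → addOrderOf f₂ = 2 → addOrderOf f₃ = 2 * n →
      IsExtremalEGZ (lowHeightSeq (heightParams n) f₁ f₂ f₃) ∧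
      (height (lowHeightSeq (heightParams n) f₁ f₂ f₃) : ℚ) = heightBound n := by
    intro f₁ f₂ f₃ hf h1 h2 h3
    obtain ⟨hp, hp1, hp2, hp3⟩ := heightParams_spec hn
    have hext : IsExtremalEGZ (lowHeightSeq (heightParams n) f₁ f₂ f₃) :=
      (isExtremalEGZ_iff hn e).2 ⟨by rw [card_lowHeightSeq]; omega,
        lowHeightSeq_not_hasZeroSumSubseq hp hf h1 h2 h3⟩
    obtain ⟨h6, hle⟩ := hlower _ hext
    refine ⟨hext, le_antisymm ?_ hle⟩
    rw [← hp3]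
    exact_mod_cast height_lowHeightSeq_le hp1 hp2 h6
  refine ⟨fun S hS => (hlower S hS).2, ?_, hexpl⟩
  obtain ⟨f₁, f₂, f₃, hf, h1, h2, h3⟩ := exists_isGroupBasis e
  exact ⟨_, hexpl f₁ f₂ f₃ hf h1 h2 h3⟩
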